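/- Let $\Gamma$ be a finite quiver with vertex set $I$ whose underlying graph is a disjoint union of Dynkin diagrams of types $A_n$ ($n\ge 1$), $D_n$ ($n\ge 4$), $E_6,E_7,E_8$, and let $k$ be an algebraically closed field. Let $\Phi$ be the root system of this graph, with simple roots $\alpha_i$ $(i\in I)$, set of positive roots $\Phi_{>0}$ and root lattice $Q=\mathbb{Z}\Phi$, and let $\Phi_{\ge -1}=\Phi_{>0}\cup\{-\alpha_i : i\in I\}$ be the set of almost positive roots. A decorated representation of $\Gamma$ is a finite-dimensional $k$-representation of the quiver obtained from $\Gamma$ by adding, for each $i\in I$, one new vertex $i^-$ and no new arrows; it is written $M=M^+\oplus V$, where $M^+=(M_i)_{i\in I}$ is a representation of $\Gamma$ and $V=(V_i)_{i\in I}$ is the $I$-graded vector space formed by the spaces at the vertices $i^-$. Its signed dimension vector is $\sum_{i\in I}(\dim M_i-\dim V_i)\alpha_i$. For $\alpha\in\Phi_{\ge -1}$ let $U_\alpha$ denote the indecomposable decorated representation with signed dimension vector $\alpha$, which exists and is unique up to isomorphism. For decorated representations $M=M^+\oplus V$ and $N=N^+\oplus W$ put $$E_\Gamma(M,N)=\mathrm{Ext}^1_\Gamma(M^+,N^+)\oplus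 \mathrm{Ext}^1_\Gamma(N^+,M^+)^*\oplus\bigoplus_{i\in I}\mathrm{Hom}_k(M_i,W_i)\oplus\bigoplus_{i\in I}\mathrm{Hom}_k(V_i,N_i),$$ and let $(\alpha\|\beta)_\Gamma=\dim_k E_\Gamma(U_\alpha,U_\beta)$ for $\alpha,\beta\in\Phi_{\ge -1}$. A subset $C\subseteq\Phi_{\ge -1}$ is $\Gamma$-compatible if $(\alpha\|\beta)_\Gamma=0$ for all $\alpha,\beta\in C$, and a $\Gamma$-cluster is a $\Gamma$-compatible subset that is maximal with respect to inclusion. **Proposition (Purity).** All $\Gamma$-clusters have the same size $n$, the rank of the root system $\Phi$. Moreover, each $\Gamma$-cluster is a $\mathbb{Z}$-basis of the root lattice $Q$. -/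

import Mathlib

open CategoryTheory

universe u v w

namespace DynkinQuiver

/-! ### Dynkin quivers and their root systems -/

/-- The simply-laced connected Dynkin types `A_n` (`n ≥ 1`), `D_n` (`n ≥ 4`), `E_6`, `E_7`, `E_8`. -/
inductive ADEType : Type
  | A (n : ℕ) (hn : 1 ≤ n)
  | D (n : ℕ) (hn : 4 ≤ n)
  | E₆
  | E₇
  | E₈

/-- The number of vertices of the Dynkin diagram of a given type. -/
def ADEType.numVertices : ADEType → ℕ
  | .A n _ => n
  | .D n _ => n
  | .E₆ => 6
  | .E₇ => 7
  | .E₈ => 8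

/-- The Cartan matrix of the Dynkin diagram of a given type; two distinct vertices `i`, `j` of the
diagram are joined by an edge if the entry `(i, j)` is `-1`, and not joined if it is `0`. -/
def ADEType.cartanMatrix : (t : ADEType) → Matrix (Fin t.numVertices) (Fin t.numVertices) ℤ
  | .A n _ => CartanMatrix.A n
  | .D n _ => CartanMatrix.D n
  | .E₆ => CartanMatrix.E₆
  | .E₇ => CartanMatrix.E₇
  | .E₈ => CartanMatrix.E₈

section RootSystem

variable (I : Type v) [DecidableEq I] [Quiver.{w} I]

/-- The Cartan matrix of the graph underlying a quiver: twice the identity minus the matrix which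
counts the edges (arrows in either direction) between two vertices. -/
noncomputable def cartan : Matrix I I ℤ :=
  Matrix.of fun i j => (if i = j then 2 else 0) - (Nat.card (i ⟶ j) : ℤ) - (Nat.card (j ⟶ i) : ℤ)

/-- The graph underlying the quiver is a disjoint union of Dynkin diagrams of types `A_n`, `D_n`,
`E_6`, `E_7`, `E_8` (there are no loops, since the diagonal entries of the Cartan matrices of these
diagrams are `2`). To be used for quivers with finitely many vertices and arrows. -/
def IsDynkin : Prop :=
  ∃ (m : ℕ) (t : Fin m → ADEType) (e : I ≃ Σ r : Fin m, Fin (t r).numVertices),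
    ∀ i j : I, cartan I i j = Matrix.blockDiagonal' (fun r => (t r).cartanMatrix) (e i) (e j)

variable {I}

/-- The simple root `α_i`; the free abelian group on the simple roots is `I → ℤ`. -/
def simpleRoot (i : I) : I → ℤ := Pi.single i 1

/-- The simple reflection `s_i (v) = v - ⟨v, α_i^∨⟩ α_i`. -/
noncomputable def simpleReflection [Fintype I] (i : I) (x : I → ℤ) : I → ℤ :=
  x - ((cartan I).mulVec x i) • simpleRoot i

/-- The roots of the root system attached to the Cartan matrix: the images of the simple roots
under the Weyl group, which is generated by the simple reflections. -/
inductive IsRoot [Fintype I] : (I → ℤ) → Prop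
  | simple (i : I) : IsRoot (simpleRoot i)
  | reflection (i : I) (x : I → ℤ) : IsRoot x → IsRoot (simpleReflection i x)

variable (I)

/-- The root system `Φ`. -/
def roots [Fintype I] : Set (I → ℤ) := {x | IsRoot x}

/-- The set `Φ_{>0}` of positive roots. -/
def positiveRoots [Fintype I] : Set (I → ℤ) := {x | x ∈ roots I ∧ 0 ≤ x}

/-- The set `Φ_{≥ -1}` of almost positive roots: positive roots and negatives of simple roots. -/
def almostPositiveRoots [Fintype I] : Set (I → ℤ) :=
  positiveRoots I ∪ Set.range fun i : I => -simpleRoot i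

/-- The root lattice `Q`. -/
def rootLattice [Fintype I] : Submodule ℤ (I → ℤ) := Submodule.span ℤ (roots I)

/-- The rank of `Φ`: the number of linearly independent roots, i.e. the rank of the lattice
spanned by the roots. -/
noncomputable def rank [Fintype I] : ℕ := Module.finrank ℤ (rootLattice I)

end RootSystem

/-! ### Decorated representations -/

/-- The category of finite-dimensional representations over `k` of the quiver `I`. -/
abbrev Rep (k : Type u) [Field k] (I : Type v) [Quiver.{w} I] :=
  Paths I ⥤ FGModuleCat.{u} k

/-- The vertices of the decorated quiver: the vertices `i` of the quiver and, for each of them, a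
new vertex `i⁻`. -/
inductive Decorated (I : Type v) : Type v
  | pos (i : I)
  | neg (i : I)

/-- The arrows of the decorated quiver: those of the original quiver; no arrow starts or ends at a
new vertex. -/
def Decorated.Arrow {I : Type v} [Quiver.{w} I] : Decorated I → Decorated I → Type w
  | .pos i, .pos j => i ⟶ j
  | _, _ => PEmpty

instance {I : Type v} [Quiver.{w} I] : Quiver.{w} (Decorated I) where
  Hom := Decorated.Arrow

/-- The inclusion of the quiver into the decorated quiver. -/
def Decorated.incl (I : Type v) [Quiver.{w} I] : I ⥤q Decorated I where
  obj := Decorated.pos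
  map {i j} a := (show Decorated.Arrow (.pos i) (.pos j) from a)

/-- The category of decorated representations: the representations of the decorated quiver. -/
abbrev DecRep (k : Type u) [Field k] (I : Type v) [Quiver.{w} I] := Rep k (Decorated I)

section Decorated

variable {k : Type u} [Field k] {I : Type v} [Quiver.{w} I]

/-- The component `M⁺` of a decorated representation `M = M⁺ ⊕ V`: the restriction to the original
quiver. -/
def DecRep.plus (M : DecRep k I) : Rep k I :=
  Paths.lift (Decorated.incl I ⋙q Paths.of (Decorated I)) ⋙ M

/-- The space at the vertex `i` of a representation. -/
abbrev Rep.space (M : Rep k I) (i : I) : Type u := M.obj ((Paths.of I).obj i)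

/-- The space `V_i` of a decorated representation `M = M⁺ ⊕ V`. -/
abbrev DecRep.decoration (M : DecRep k I) (i : I) : Type u := Rep.space M (Decorated.neg i)

/-- The signed dimension vector `∑ (dim M_i - dim V_i) α_i`. -/
noncomputable def DecRep.sdim (M : DecRep k I) : I → ℤ := fun i =>
  (Module.finrank k (Rep.space M.plus i) : ℤ) - (Module.finrank k (M.decoration i) : ℤ)

instance : HasExt.{max (u + 1) v w} (Rep k I) := HasExt.standard _

/-- `Ext¹` in the abelian category of finite-dimensional representations. -/
abbrev Ext1 (M N : Rep k I) : Type (max (u + 1) v w) :=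
  Abelian.Ext.{max (u + 1) v w} M N 1

/-- The space
`E(M, N) = Ext¹(M⁺, N⁺) ⊕ Ext¹(N⁺, M⁺)^* ⊕ Hom^I(M⁺, W) ⊕ Hom^I(V, N⁺)` for decorated
representations `M = M⁺ ⊕ V` and `N = N⁺ ⊕ W`. -/
abbrev ESpace (M N : DecRep k I) :=
  Ext1 M.plus N.plus × Module.Dual k (Ext1 N.plus M.plus) ×
    ((i : I) → (Rep.space M.plus i →ₗ[k] N.decoration i)) ×
    ((i : I) → (M.decoration i →ₗ[k] Rep.space N.plus i))

instance : Nonempty (DecRep k I) := ⟨(Functor.const _).obj default⟩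

variable (k)

/-- The indecomposable decorated representation `U_α` with signed dimension vector `α`. For a Dynkin
quiver and an almost positive root `α` it exists and is unique up to isomorphism. -/
noncomputable def U (α : I → ℤ) : DecRep k I :=
  Classical.epsilon fun M : DecRep k I => Indecomposable M ∧ M.sdim = α

/-- The compatibility degree `(α ‖ β) = dim E(U_α, U_β)`. -/
noncomputable def compatDegree (α β : I → ℤ) : ℕ := Module.finrank k (ESpace (U k α) (U k β))

/-- Compatible subsets of the set of almost positive roots. -/
def IsCompatible [Fintype I] [DecidableEq I] (C : Set (I → ℤ)) : Prop :=
  C ⊆ almostPositiveRoots I ∧ ∀ α ∈ C, ∀ β ∈ C, compatDegree k α β = 0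

/-- Clusters: compatible subsets which are maximal by inclusion. -/
def IsCluster [Fintype I] [DecidableEq I] (C : Set (I → ℤ)) : Prop :=
  Maximal (IsCompatible k) C

end Decorated

end DynkinQuiver

/-!
The proof replaces functors on the path category by families of linear maps, `QRep`. For these,
`Ext¹` is the cokernel of the map `δ` of the two-term complex which computes `Hom` and `Ext¹`
(`Rep.subsingleton_ext1_iff`), and the difference of the dimensions of `Hom` and `Ext¹` is the Euler
form of the dimension vectors (`QRep.homDim_sub_euler`). For a Dynkin quiver the Euler form is
positive definite (`IsDynkin.one_le_euler`), and the nonnegative vectors on which it takes the value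
one are the positive roots (`IsDynkin.isRoot_of_euler_eq_one`). By Ringel's lemma
(`QRep.Indec.rigid_and_homDim`), an indecomposable representation is a brick without
self-extensions, so its dimension vector is a positive root. Conversely, every dimension vector is
that of a rigid representation (`QRep.exists_rigid`), which is unique up to isomorphism
(`QRep.Rigid.iso`). In this way, `U_α` is the indecomposable representation of dimension vector `α`
if `α` is positive, and a line at the vertex `i⁻` if `α = -αᵢ`. Two positive roots are compatible if
there are no extensions between their representations, a positive root is compatible with `-αᵢ` if
it has no component at `i`, and negative simple roots are always compatible.

Compatible positive roots are linearly independent (`QRep.linearIndependent_dim`): a linear relation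
would give two rigid direct sums of the same dimension vector without common indecomposable summand,
and rigid representations are determined by their dimension vectors. Together with the vanishing of
the positive members of a compatible set at the vertices of its negative members, this makes every
compatible set linearly independent.

A cluster `C` spans the root lattice by Bongartz's construction. If `-αᵢ` is not in `C`, start with
a representation of dimension vector `αᵢ` and take nonsplit extensions with the `U_β`, for positive
`β ∈ C`, on either side, until no extensions remain (`QRep.exists_extZero_family`); then make the
result rigid (`QRep.exists_rigid_extZero_family`). Its indecomposable summands are compatible with
`C`, hence lie in `C` by maximality, and its dimension vector differs from `αᵢ` by an element of the
span of `C`.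
-/

namespace DynkinQuiver

/-! ### Effaceability of `Ext` -/

section Effaceable

open DerivedCategory HomologicalComplex

/-- A complex `K` which vanishes above degree `i` and has the cohomology of `X` in degree `i`
receives a map from a complex concentrated in degree `i` whose composition with `K → X[-i]` is an
epimorphism: take the term of degree `i` of `K` itself. -/
theorem exists_epi_to_single {C : Type u} [Category.{v} C] [Abelian C]
    {X : C} {K : CochainComplex C ℤ} {i : ℤ}
    (π : K ⟶ (single C (ComplexShape.up ℤ) i).obj X) [K.IsStrictlyLE i] [QuasiIsoAt π i] :
    ∃ (P : C) (p : P ⟶ X) (σ : (single C (ComplexShape.up ℤ) i).obj P ⟶ K),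
      Epi p ∧ σ ≫ π = (single C (ComplexShape.up ℤ) i).map p := by
  let e := K.iCyclesIso i (i + 1) (by simp)
    ((K.isZero_of_isStrictlyLE i (i + 1) (by simp)).eq_of_tgt _ _)
  let α := e.inv ≫ K.homologyπ i ≫ homologyMap π i ≫ (singleObjHomologySelfIso _ _ _).hom
  have hα : π.f i = α ≫ (singleObjXSelf (ComplexShape.up ℤ) i X).inv := by
    rw [← cancel_epi e.hom]
    dsimp only [α, e]
    rw [Category.assoc, Category.assoc, Category.assoc, Iso.hom_inv_id_assoc,
      homologyπ_naturality_assoc, homologyπ_singleObjHomologySelfIso_hom_assoc,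
      ← singleObjCyclesSelfIso_inv_iCycles, Iso.hom_inv_id_assoc, cyclesMap_i, iCyclesIso_hom]
  refine ⟨K.X i, α, mkHomFromSingle (𝟙 _) (fun k hk =>
      (K.isZero_of_isStrictlyLE i k (by have : i + 1 = k := hk; omega)).eq_of_tgt _ _), ?_, ?_⟩
  · dsimp only [α]
    infer_instance
  · apply HomologicalComplex.from_single_hom_ext
    rw [comp_f, mkHomFromSingle_f, single_map_f_self, hα]
    simp

/-- Every class in `Ext^(n+1)(X, Y)` is killed by the pullback along some epimorphism `P → X`. The
class is a fraction of a quasi-isomorphism `K → X` and a map `K → Y[n+1]` with `K` vanishing in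
positive degrees, and any map from the term of degree zero of `K` to `Y[n+1]` is zero. -/
theorem exists_epi_mk₀_comp_eq_zero {C : Type u} [Category.{v} C] [Abelian C] [HasExt.{w} C]
    {X Y : C} {n : ℕ} (e : Abelian.Ext.{w} X Y (n + 1)) :
    ∃ (P : C) (p : P ⟶ X), Epi p ∧ (Abelian.Ext.mk₀ p).comp e (zero_add _) = 0 := by
  let := HasDerivedCategory.standard C
  obtain ⟨K, _, π, h, g, hg⟩ := right_fac_of_isStrictlyLE
    (X := (CochainComplex.singleFunctor C 0).obj X)
    (Y := (CochainComplex.singleFunctor C (-(n + 1))).obj Y)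
    (e.hom ≫ ((singleFunctors C).shiftIso (n + 1) (-(n + 1)) 0 (by lia)).hom.app _) 0
  have hq := h
  rw [isIso_Q_map_iff_quasiIso] at hq
  have hq₀ : QuasiIsoAt π 0 := hq.quasiIsoAt 0
  obtain ⟨P, p, σ, hp, hσ⟩ : ∃ (P : C) (p : P ⟶ X)
      (σ : (CochainComplex.singleFunctor C 0).obj P ⟶ K),
      Epi p ∧ σ ≫ π = (CochainComplex.singleFunctor C 0).map p :=
    @exists_epi_to_single C _ _ X K 0 π _ hq₀
  refine ⟨P, p, hp, ?_⟩
  have hσg : σ ≫ g = 0 := by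
    apply HomologicalComplex.from_single_hom_ext
    apply (((CochainComplex.singleFunctor C (-(n + 1))).obj Y).isZero_of_isStrictlyLE
      (-(n + 1)) 0 (by lia)).eq_of_tgt
  have hinv : Q.map ((CochainComplex.singleFunctor C 0).map p) ≫ inv (Q.map π) = Q.map σ := by
    rw [← hσ, Q.map_comp, Category.assoc, IsIso.hom_inv_id, Category.comp_id]
  have key : Q.map ((CochainComplex.singleFunctor C 0).map p) ≫ inv (Q.map π) ≫ Q.map g = 0 := by
    rw [← Category.assoc, hinv, ← Q.map_comp, hσg, Q.map_zero]
  ext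
  rw [← cancel_mono (((singleFunctors C).shiftIso (n + 1) (-(n + 1)) 0
    (by lia)).hom.app _)]
  rw [Abelian.Ext.comp_hom, Abelian.Ext.mk₀_hom, ShiftedHom.mk₀_comp]
  simp only [Abelian.Ext.zero_hom, Limits.zero_comp]
  erw [Category.assoc, hg]
  exact key

end Effaceable

theorem exact_iff_evaluation {J : Type*} [Category J] {C : Type*} [Category C] [Abelian C]
    (S : ShortComplex (J ⥤ C)) :
    S.Exact ↔ ∀ j, (S.map ((evaluation J C).obj j)).Exact := by
  simp only [ShortComplex.exact_iff_isZero_homology]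
  rw [Functor.isZero_iff]
  refine forall_congr' fun j => ?_
  exact (S.mapHomologyIso ((evaluation J C).obj j)).isZero_iff.symm

/-! ### Representations as families of linear maps -/

/-- A finite-dimensional representation of a quiver, given by its spaces and its linear maps. Unlike
an object of `Rep k I`, it carries no data for paths of length other than one. -/
structure QRep (k : Type u) [Field k] (I : Type v) [Quiver.{w} I] where
  /-- The space at a vertex. -/
  V : I → Type u
  [addCommGroup : ∀ i, AddCommGroup (V i)]
  [module : ∀ i, Module k (V i)]
  [finite : ∀ i, Module.Finite k (V i)]
  /-- The linear map along an arrow. -/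
  map : ∀ {i j : I}, (i ⟶ j) → V i →ₗ[k] V j

namespace QRep

attribute [instance] QRep.addCommGroup QRep.module QRep.finite

variable {k : Type u} [Field k] {I : Type v} [Quiver.{w} I]

/-- Families of linear maps between the spaces of two representations. -/
abbrev Fam (M N : QRep k I) : Type (max u v) := ∀ i, M.V i →ₗ[k] N.V i

/-- Families of linear maps, indexed by the arrows, from the space of `M` at the source to the space
of `N` at the target. They are the cocycles of the extensions of `M` by `N`. -/
abbrev Cochain (M N : QRep k I) : Type (max u v w) := ∀ (i j : I) (_ : i ⟶ j), M.V i →ₗ[k] N.V j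

/-- Composition of families, in the order of the composition of functions. -/
def Fam.comp {L M N : QRep k I} (g : Fam M N) (f : Fam L M) : Fam L N := fun i => g i ∘ₗ f i

/-- The identity family. -/
def Fam.id (M : QRep k I) : Fam M M := fun _ => LinearMap.id

@[simp] theorem Fam.comp_apply {L M N : QRep k I} (g : Fam M N) (f : Fam L M) (i : I) (x : L.V i) :
    g.comp f i x = g i (f i x) := rfl

@[simp] theorem Fam.id_apply (M : QRep k I) (i : I) (x : M.V i) : Fam.id M i x = x := rfl

theorem Fam.ext' {M N : QRep k I} {f g : Fam M N} (h : ∀ i x, f i x = g i x) : f = g :=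
  funext fun i => LinearMap.ext (h i)

theorem Fam.comp_assoc {K L M N : QRep k I} (h : Fam M N) (g : Fam L M) (f : Fam K L) :
    (h.comp g).comp f = h.comp (g.comp f) := rfl

@[simp] theorem Fam.comp_id {M N : QRep k I} (f : Fam M N) : f.comp (Fam.id M) = f := rfl

@[simp] theorem Fam.id_comp {M N : QRep k I} (f : Fam M N) : (Fam.id N).comp f = f := rfl

@[simp] theorem Fam.comp_zero {L M N : QRep k I} (g : Fam M N) : g.comp (0 : Fam L M) = 0 :=
  Fam.ext' fun i x => by simp

@[simp] theorem Fam.zero_comp {L M N : QRep k I} (f : Fam L M) : (0 : Fam M N).comp f = 0 := rfl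

theorem Fam.add_comp {L M N : QRep k I} (g g' : Fam M N) (f : Fam L M) :
    (g + g').comp f = g.comp f + g'.comp f := rfl

theorem Fam.comp_add {L M N : QRep k I} (g : Fam M N) (f f' : Fam L M) :
    g.comp (f + f') = g.comp f + g.comp f' :=
  Fam.ext' fun i x => by simp

theorem Fam.sub_comp {L M N : QRep k I} (g g' : Fam M N) (f : Fam L M) :
    (g - g').comp f = g.comp f - g'.comp f := rfl

theorem Fam.comp_sub {L M N : QRep k I} (g : Fam M N) (f f' : Fam L M) :
    g.comp (f - f') = g.comp f - g.comp f' :=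
  Fam.ext' fun i x => by simp

theorem Fam.smul_comp {L M N : QRep k I} (c : k) (g : Fam M N) (f : Fam L M) :
    (c • g).comp f = c • g.comp f := rfl

theorem Fam.comp_smul {L M N : QRep k I} (c : k) (g : Fam M N) (f : Fam L M) :
    g.comp (c • f) = c • g.comp f :=
  Fam.ext' fun i x => by simp

/-- The defect of commutativity of a family with the arrows. Its kernel is `Hom(M, N)` and its
cokernel is `Ext¹(M, N)`. -/
def δ (M N : QRep k I) : Fam M N →ₗ[k] Cochain M N where
  toFun f _ _ a := f _ ∘ₗ M.map a - N.map a ∘ₗ f _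
  map_add' f g := by
    funext i j a
    ext x
    simp
    abel
  map_smul' c f := by
    funext i j a
    ext x
    simp [smul_sub]

@[simp] theorem δ_apply (M N : QRep k I) (f : Fam M N) {i j : I} (a : i ⟶ j) (x : M.V i) :
    δ M N f i j a x = f j (M.map a x) - N.map a (f i x) := rfl

/-- The space of homomorphisms of representations. -/
def Hom (M N : QRep k I) : Submodule k (Fam M N) := LinearMap.ker (δ M N)

theorem mem_Hom {M N : QRep k I} {f : Fam M N} :
    f ∈ Hom M N ↔ ∀ {i j : I} (a : i ⟶ j) (x : M.V i), f j (M.map a x) = N.map a (f i x) := by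
  constructor
  · intro h i j a x
    have := congrArg (fun c : Cochain M N => c i j a x) (LinearMap.mem_ker.1 h)
    simpa [sub_eq_zero] using this
  · intro h
    refine LinearMap.mem_ker.2 ?_
    funext i j a
    ext x
    simp [h]

theorem Hom.comp {L M N : QRep k I} {g : Fam M N} {f : Fam L M} (hg : g ∈ Hom M N)
    (hf : f ∈ Hom L M) : g.comp f ∈ Hom L N := by
  rw [mem_Hom] at *
  intro i j a x
  simp [hf, hg]

theorem Hom.id (M : QRep k I) : Fam.id M ∈ Hom M M := by
  rw [mem_Hom]
  intro i j a x
  simp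

/-- Vanishing of `Ext¹(M, N)`, that is, surjectivity of the map `δ` of which `Ext¹(M, N)` is the
cokernel. -/
def ExtZero (M N : QRep k I) : Prop := Function.Surjective (δ M N)

/-- A representation without self-extensions. -/
def Rigid (M : QRep k I) : Prop := ExtZero M M

/-- `Ext¹(-, N)` is right exact: it turns injections into surjections. -/
theorem ExtZero.of_injective {A B N : QRep k I} {ι : Fam A B} (hι : ι ∈ Hom A B)
    (hinj : ∀ i, Function.Injective (ι i)) (h : ExtZero B N) : ExtZero A N := by
  intro c
  choose r hr using fun i => (ι i).exists_leftInverse_of_injective (LinearMap.ker_eq_bot.2 (hinj i))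
  obtain ⟨f, hf⟩ := h fun i j a => c i j a ∘ₗ r i
  refine ⟨f.comp ι, ?_⟩
  funext i j a
  ext x
  have h1 := LinearMap.congr_fun (congrFun (congrFun (congrFun hf i) j) a) (ι i x)
  have h2 := LinearMap.congr_fun (hr i) x
  simp only [LinearMap.comp_apply, LinearMap.id_apply] at h2
  simp only [δ_apply, LinearMap.comp_apply, h2] at h1
  simp [← h1, mem_Hom.1 hι]

/-- `Ext¹(M, -)` is right exact: it preserves surjections. -/
theorem ExtZero.of_surjective {M A B : QRep k I} {π : Fam A B} (hπ : π ∈ Hom A B)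
    (hsurj : ∀ i, Function.Surjective (π i)) (h : ExtZero M A) : ExtZero M B := by
  intro c
  choose s hs using fun i => (π i).exists_rightInverse_of_surjective
    (LinearMap.range_eq_top.2 (hsurj i))
  obtain ⟨f, hf⟩ := h fun i j a => s j ∘ₗ c i j a
  refine ⟨π.comp f, ?_⟩
  funext i j a
  ext x
  have h1 := congrArg (π j) (LinearMap.congr_fun (congrFun (congrFun (congrFun hf i) j) a) x)
  have h2 := LinearMap.congr_fun (hs j) (c i j a x)
  simp only [LinearMap.comp_apply, LinearMap.id_apply] at h2
  simp only [δ_apply, LinearMap.comp_apply, map_sub, h2] at h1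
  simp [← h1, mem_Hom.1 hπ]

/-! ### Dimensions and the Euler form -/

/-- The dimension vector. -/
noncomputable def dim (M : QRep k I) : I → ℤ := fun i => Module.finrank k (M.V i)

theorem dim_nonneg (M : QRep k I) : 0 ≤ M.dim := fun i => by simp [dim]

/-- The dimension of `Hom(M, N)`. -/
noncomputable def homDim (M N : QRep k I) : ℤ := Module.finrank k (Hom M N)

end QRep

/-- The Euler form of a quiver. -/
noncomputable def euler {I : Type v} [Quiver.{w} I] [Fintype I] (d e : I → ℤ) : ℤ :=
  ∑ i, d i * e i - ∑ i, ∑ j, (Nat.card (i ⟶ j) : ℤ) * (d i * e j)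

section Euler

variable {I : Type v} [Quiver.{w} I] [Fintype I]

theorem euler_add_left (d d' e : I → ℤ) : euler (d + d') e = euler d e + euler d' e := by
  simp only [euler, Pi.add_apply, add_mul, mul_add, Finset.sum_add_distrib]
  ring

theorem euler_add_right (d e e' : I → ℤ) : euler d (e + e') = euler d e + euler d e' := by
  simp only [euler, Pi.add_apply, mul_add, Finset.sum_add_distrib]
  ring

end Euler

namespace QRep

variable {k : Type u} [Field k] {I : Type v} [Quiver.{w} I] [Fintype I] [∀ i j : I, Finite (i ⟶ j)]

theorem homDim_sub_euler (M N : QRep k I) :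
    homDim M N - euler M.dim N.dim =
      Module.finrank k (Cochain M N) - Module.finrank k (LinearMap.range (δ M N)) := by
  classical
  have h1 := LinearMap.finrank_range_add_finrank_ker (δ M N)
  have h2 : (Module.finrank k (Fam M N) : ℤ) = ∑ i, M.dim i * N.dim i := by
    rw [Module.finrank_pi_fintype]
    simp [Module.finrank_linearMap, dim]
  have h3 : (Module.finrank k (Cochain M N) : ℤ) =
      ∑ i, ∑ j, (Nat.card (i ⟶ j) : ℤ) * (M.dim i * N.dim j) := by
    rw [Module.finrank_pi_fintype]
    push_cast
    refine Finset.sum_congr rfl fun i _ => ?_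
    rw [Module.finrank_pi_fintype]
    push_cast
    refine Finset.sum_congr rfl fun j _ => ?_
    have := Fintype.ofFinite (i ⟶ j)
    rw [Module.finrank_pi_fintype]
    simp [Module.finrank_linearMap, dim]
  have h4 : (Module.finrank k (LinearMap.range (δ M N)) : ℤ) + homDim M N
    = Module.finrank k (Fam M N) := by
    rw [homDim, Hom]
    exact_mod_cast h1
  rw [euler, h3, ← h2]
  linarith

theorem euler_le_homDim (M N : QRep k I) : euler M.dim N.dim ≤ homDim M N := by
  have h := homDim_sub_euler M N
  have : Module.finrank k (LinearMap.range (δ M N)) ≤ Module.finrank k (Cochain M N) :=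
    Submodule.finrank_le _
  have : (Module.finrank k (LinearMap.range (δ M N)) : ℤ) ≤ Module.finrank k (Cochain M N) := by
    exact_mod_cast this
  linarith

theorem extZero_iff (M N : QRep k I) : ExtZero M N ↔ homDim M N = euler M.dim N.dim := by
  have h := homDim_sub_euler M N
  rw [ExtZero, ← LinearMap.range_eq_top]
  constructor
  · intro ht
    rw [ht, finrank_top] at h
    linarith
  · intro he
    apply Submodule.eq_top_of_finrank_eq
    have : (Module.finrank k (LinearMap.range (δ M N)) : ℤ) = Module.finrank k (Cochain M N) := by
      linarith
    exact_mod_cast this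

end QRep

namespace QRep

variable {k : Type u} [Field k] {I : Type v} [Quiver.{w} I]

/-! ### Extensions -/

/-- The extension of `M` by `N` with a given cocycle: the direct sum of the spaces, with block
triangular maps along the arrows. -/
def extension {M N : QRep k I} (c : Cochain M N) : QRep k I where
  V i := N.V i × M.V i
  map {i j} a := (N.map a ∘ₗ LinearMap.fst k _ _ + c i j a ∘ₗ LinearMap.snd k _ _).prod
    (M.map a ∘ₗ LinearMap.snd k _ _)

namespace extension

variable {M N : QRep k I} (c : Cochain M N)

/-- The inclusion of `N` into an extension of `M` by `N`. -/
def inl : Fam N (extension c) := fun i => LinearMap.inl k (N.V i) (M.V i)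

/-- The inclusion of the spaces of `M` into those of an extension of `M` by `N`. -/
def inr : Fam M (extension c) := fun i => LinearMap.inr k (N.V i) (M.V i)

/-- The projection of the spaces of an extension of `M` by `N` onto those of `N`. -/
def fst : Fam (extension c) N := fun i => LinearMap.fst k (N.V i) (M.V i)

/-- The projection of an extension of `M` by `N` onto `M`. -/
def snd : Fam (extension c) M := fun i => LinearMap.snd k (N.V i) (M.V i)

@[simp] theorem fst_inl (i : I) (x : N.V i) : fst c i (inl c i x) = x := rfl

@[simp] theorem snd_inl (i : I) (x : N.V i) : snd c i (inl c i x) = 0 := rfl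

@[simp] theorem fst_inr (i : I) (x : M.V i) : fst c i (inr c i x) = 0 := rfl

@[simp] theorem snd_inr (i : I) (x : M.V i) : snd c i (inr c i x) = x := rfl

@[simp] theorem fst_map {i j : I} (a : i ⟶ j) (x : (extension c).V i) :
    fst c j ((extension c).map a x) = N.map a (fst c i x) + c i j a (snd c i x) := rfl

@[simp] theorem snd_map {i j : I} (a : i ⟶ j) (x : (extension c).V i) :
    snd c j ((extension c).map a x) = M.map a (snd c i x) := rfl

variable {c} in
theorem ext {i : I} {x y : (extension c).V i} (h1 : fst c i x = fst c i y)
    (h2 : snd c i x = snd c i y) : x = y :=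
  Prod.ext h1 h2

theorem inl_add_inr (i : I) (x : (extension c).V i) :
    inl c i (fst c i x) + inr c i (snd c i x) = x :=
  ext (by simp) (by simp)

theorem inl_mem : inl c ∈ Hom N (extension c) := by
  rw [mem_Hom]
  intro i j a x
  exact ext (by simp) (by simp)

theorem snd_mem : snd c ∈ Hom (extension c) M := by
  rw [mem_Hom]
  intro i j a x
  simp

theorem dim_eq : (extension c).dim = N.dim + M.dim := by
  funext i
  change ((Module.finrank k (N.V i × M.V i) : ℕ) : ℤ) = _
  rw [Module.finrank_prod]
  simp [dim]

variable {c}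

/-- The sequence `0 → Hom(A, N) → Hom(A, E) → Hom(A, M)` is exact. -/
theorem exists_of_snd_comp_eq_zero {A : QRep k I} {f : Fam A (extension c)}
    (hf : f ∈ Hom A (extension c)) (h : (snd c).comp f = 0) :
    ∃ g ∈ Hom A N, (inl c).comp g = f := by
  have h' : ∀ i x, snd c i (f i x) = 0 := fun i x => LinearMap.congr_fun (congrFun h i) x
  refine ⟨(fst c).comp f, ?_, ?_⟩
  · rw [mem_Hom] at hf ⊢
    intro i j a x
    simp [hf, h']
  · exact Fam.ext' fun i x => ext (by simp) (by simp [h'])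

/-- The sequence `0 → Hom(M, B) → Hom(E, B) → Hom(N, B)` is exact. -/
theorem exists_of_comp_inl_eq_zero {B : QRep k I} {f : Fam (extension c) B}
    (hf : f ∈ Hom (extension c) B) (h : f.comp (inl c) = 0) :
    ∃ g ∈ Hom M B, g.comp (snd c) = f := by
  have h' : ∀ i (x : N.V i), f i (inl c i x) = 0 :=
    fun i x => LinearMap.congr_fun (congrFun h i) x
  have h2 : ∀ i (x : (extension c).V i), f i x = f i (inr c i (snd c i x)) := by
    intro i x
    conv_lhs => rw [← inl_add_inr c i x, map_add, h', zero_add]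
  refine ⟨f.comp (inr c), ?_, ?_⟩
  · rw [mem_Hom] at hf ⊢
    intro i j a x
    rw [Fam.comp_apply, Fam.comp_apply, ← hf, h2 j ((extension c).map a _)]
    simp
  · exact Fam.ext' fun i x => (h2 i x).symm

/-- An extension with a section has a trivial cocycle. -/
theorem mem_range_δ_of_section {f : Fam M (extension c)} (hf : f ∈ Hom M (extension c))
    (h : (snd c).comp f = Fam.id M) : c ∈ LinearMap.range (δ M N) := by
  have h' : ∀ i x, snd c i (f i x) = x := fun i x => LinearMap.congr_fun (congrFun h i) x
  refine ⟨(fst c).comp f, ?_⟩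
  funext i j a
  ext x
  simp [mem_Hom.1 hf, h']

/-- An extension with a retraction onto the subrepresentation has a trivial cocycle. -/
theorem mem_range_δ_of_retraction  {r : Fam (extension c) N} (hr : r ∈ Hom (extension c) N)
    (h : r.comp (extension.inl c) = Fam.id N) : c ∈ LinearMap.range (δ M N) := by
  have h' : ∀ i (x : N.V i), r i (inl c i x) = x :=
    fun i x => LinearMap.congr_fun (congrFun h i) x
  refine ⟨-r.comp (inr c), ?_⟩
  funext i j a
  ext x
  have h1 : (extension c).map a (inr c i x) = inl c j (c i j a x) + inr c j (M.map a x) :=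
    ext (by simp) (by simp)
  have h2 := mem_Hom.1 hr a (inr c i x)
  rw [h1, map_add, h'] at h2
  simp [← h2]

/-- An extension with a trivial cocycle has a section. -/
theorem exists_section_of_mem_range_δ (h : c ∈ LinearMap.range (δ M N)) :
    ∃ f ∈ Hom M (extension c), (snd c).comp f = Fam.id M := by
  obtain ⟨g, rfl⟩ := h
  refine ⟨(inl _).comp g + inr _, ?_, ?_⟩
  · rw [mem_Hom]
    intro i j a x
    exact ext (by simp) (by simp)
  · exact Fam.ext' fun i x => by simp

end extension

/-- Composition with a fixed family, as a linear map between spaces of homomorphisms. -/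
def Hom.postcomp {M N : QRep k I} (A : QRep k I) {g : Fam M N} (hg : g ∈ Hom M N) :
    Hom A M →ₗ[k] Hom A N where
  toFun f := ⟨g.comp f.1, Hom.comp hg f.2⟩
  map_add' f f' := Subtype.ext (Fam.comp_add g f.1 f'.1)
  map_smul' c f := Subtype.ext (Fam.comp_smul c g f.1)

/-- Precomposition with a fixed family, as a linear map between spaces of homomorphisms. -/
def Hom.precomp {M N : QRep k I} (B : QRep k I) {g : Fam M N} (hg : g ∈ Hom M N) :
    Hom N B →ₗ[k] Hom M B where
  toFun f := ⟨f.1.comp g, Hom.comp f.2 hg⟩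
  map_add' f f' := Subtype.ext (Fam.add_comp f.1 f'.1 g)
  map_smul' c f := Subtype.ext (Fam.smul_comp c f.1 g)

section Bounds

variable {M N : QRep k I} (c : Cochain M N) [Finite I]

theorem homDim_extension_right_aux (A : QRep k I) :
    homDim A (extension c) ≤ homDim A N +
      Module.finrank k (LinearMap.range (Hom.postcomp A (extension.snd_mem c))) := by
  have h1 := LinearMap.finrank_range_add_finrank_ker (Hom.postcomp A (extension.snd_mem c))
  have h2 : LinearMap.ker (Hom.postcomp A (extension.snd_mem c)) ≤
      LinearMap.range (Hom.postcomp A (extension.inl_mem c)) := by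
    intro f hf
    obtain ⟨g, hg, hgf⟩ := extension.exists_of_snd_comp_eq_zero f.2 (congrArg Subtype.val hf)
    exact ⟨⟨g, hg⟩, Subtype.ext hgf⟩
  have h3 := (Submodule.finrank_mono h2).trans (LinearMap.finrank_range_le _)
  simp only [homDim]
  omega

theorem homDim_extension_right_le (A : QRep k I) :
    homDim A (extension c) ≤ homDim A N + homDim A M := by
  refine (homDim_extension_right_aux c A).trans ?_
  have := Submodule.finrank_le (LinearMap.range (Hom.postcomp A (extension.snd_mem c)))
  simp only [homDim]
  omega

/-- For a nonsplit extension the identity of `M` does not lift, so that the bound on the dimension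
of `Hom(M, E)` is strict. -/
theorem homDim_extension_right_lt (hc : c ∉ LinearMap.range (δ M N)) :
    homDim M (extension c) < homDim M N + homDim M M := by
  refine (homDim_extension_right_aux c M).trans_lt ?_
  have : LinearMap.range (Hom.postcomp M (extension.snd_mem c)) < ⊤ := by
    rw [lt_top_iff_ne_top]
    intro htop
    have : (⟨Fam.id M, Hom.id M⟩ : Hom M M) ∈
      LinearMap.range (Hom.postcomp M (extension.snd_mem c)) := htop ▸ Submodule.mem_top
    obtain ⟨f, hf⟩ := this
    exact hc (extension.mem_range_δ_of_section f.2 (congrArg Subtype.val hf))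
  have := Submodule.finrank_lt_finrank_of_lt this
  rw [finrank_top] at this
  simp only [homDim]
  omega

theorem homDim_extension_left_aux (B : QRep k I) :
    homDim (extension c) B ≤
      Module.finrank k (LinearMap.range (Hom.precomp B (extension.inl_mem c))) + homDim M B := by
  have h1 := LinearMap.finrank_range_add_finrank_ker (Hom.precomp B (extension.inl_mem c))
  have h2 : LinearMap.ker (Hom.precomp B (extension.inl_mem c)) ≤
      LinearMap.range (Hom.precomp B (extension.snd_mem c)) := by
    intro f hf
    obtain ⟨g, hg, hgf⟩ := extension.exists_of_comp_inl_eq_zero f.2 (congrArg Subtype.val hf)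
    exact ⟨⟨g, hg⟩, Subtype.ext hgf⟩
  have h3 := (Submodule.finrank_mono h2).trans (LinearMap.finrank_range_le _)
  simp only [homDim]
  omega

theorem homDim_extension_left_le (B : QRep k I) :
    homDim (extension c) B ≤ homDim N B + homDim M B := by
  refine (homDim_extension_left_aux c B).trans ?_
  have := Submodule.finrank_le (LinearMap.range (Hom.precomp B (extension.inl_mem c)))
  simp only [homDim]
  omega

/-- For a nonsplit extension the identity of `N` does not extend, so that the bound on the dimension
of `Hom(E, N)` is strict. -/
theorem homDim_extension_left_lt (hc : c ∉ LinearMap.range (δ M N)) :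
    homDim (extension c) N < homDim N N + homDim M N := by
  refine (homDim_extension_left_aux c N).trans_lt ?_
  have : LinearMap.range (Hom.precomp N (extension.inl_mem c)) < ⊤ := by
    rw [lt_top_iff_ne_top]
    intro htop
    have : (⟨Fam.id N, Hom.id N⟩ : Hom N N) ∈
      LinearMap.range (Hom.precomp N (extension.inl_mem c)) := htop ▸ Submodule.mem_top
    obtain ⟨f, hf⟩ := this
    exact hc (extension.mem_range_δ_of_retraction f.2 (congrArg Subtype.val hf))
  have := Submodule.finrank_lt_finrank_of_lt this
  rw [finrank_top] at this
  simp only [homDim]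
  omega

end Bounds

end QRep

section Comparison

variable {k : Type u} [Field k] {I : Type v} [Quiver.{w} I]

/-! ### Comparison with functors on the path category -/

/-- The spaces and linear maps of a representation. -/
def Rep.toQ (M : Rep k I) : QRep k I where
  V i := Rep.space M i
  map a := (M.map ((Paths.of I).map a)).hom.hom

/-- The functor on the path category defined by spaces and linear maps. -/
def QRep.toRep (X : QRep k I) : Rep k I :=
  Paths.lift { obj := fun i => FGModuleCat.of k (X.V i)
               map := fun a => FGModuleCat.ofHom (X.map a) }

theorem QRep.toQ_toRep (X : QRep k I) : X.toRep.toQ = X := rfl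

/-- The morphism of functors defined by a homomorphism. -/
def Rep.homMk {M N : Rep k I} {f : QRep.Fam M.toQ N.toQ} (hf : f ∈ QRep.Hom M.toQ N.toQ) : M ⟶ N :=
  Paths.liftNatTrans (fun i => FGModuleCat.ofHom (f i)) (by
    intro i j a
    ext x
    exact QRep.mem_Hom.1 hf a x)

/-- The family of linear maps underlying a morphism of functors. -/
def Rep.homFam {M N : Rep k I} (f : M ⟶ N) : QRep.Fam M.toQ N.toQ := fun i =>
  (f.app ((Paths.of I).obj i)).hom.hom

theorem Rep.homFam_mem {M N : Rep k I} (f : M ⟶ N) : Rep.homFam f ∈ QRep.Hom M.toQ N.toQ := by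
  rw [QRep.mem_Hom]
  intro i j a x
  have h := f.naturality ((Paths.of I).map a)
  exact LinearMap.congr_fun (congrArg (fun g => g.hom.hom) h) x

theorem Rep.hom_ext {M N : Rep k I} {f g : M ⟶ N} (h : Rep.homFam f = Rep.homFam g) : f = g := by
  apply NatTrans.ext
  funext i
  apply FGModuleCat.hom_ext
  exact congrFun h i

theorem Rep.homFam_id (M : Rep k I) : Rep.homFam (𝟙 M) = QRep.Fam.id _ := rfl

theorem Rep.homFam_zero (M N : Rep k I) : Rep.homFam (0 : M ⟶ N) = 0 := rfl

open Limits in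
theorem Rep.shortExact_iff (S : ShortComplex (Rep k I)) : S.ShortExact ↔
    (∀ i, Function.Injective (Rep.homFam S.f i)) ∧ (∀ i, Function.Surjective (Rep.homFam S.g i)) ∧
      ∀ i x, Rep.homFam S.g i x = 0 → ∃ y, Rep.homFam S.f i y = x := by
  have h1 : Mono S.f ↔ ∀ i, Function.Injective (Rep.homFam S.f i) := by
    rw [NatTrans.mono_iff_mono_app]
    refine forall_congr' fun i => ?_
    rw [← (forget₂ (FGModuleCat.{u} k) (ModuleCat.{u} k)).mono_map_iff_mono]
    exact ModuleCat.mono_iff_injective _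
  have h2 : Epi S.g ↔ ∀ i, Function.Surjective (Rep.homFam S.g i) := by
    rw [NatTrans.epi_iff_epi_app]
    refine forall_congr' fun i => ?_
    rw [← (forget₂ (FGModuleCat.{u} k) (ModuleCat.{u} k)).epi_map_iff_epi]
    exact ModuleCat.epi_iff_surjective _
  have h3 : S.Exact ↔ ∀ i x, Rep.homFam S.g i x = 0 → ∃ y, Rep.homFam S.f i y = x := by
    rw [exact_iff_evaluation]
    refine forall_congr' fun i => ?_
    rw [← ShortComplex.exact_map_iff_of_faithful _ (forget₂ (FGModuleCat.{u} k) (ModuleCat.{u} k))]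
    exact ShortComplex.moduleCat_exact_iff _
  rw [← h1, ← h2, ← h3]
  refine ⟨fun h => ⟨h.mono_f, h.epi_g, h.exact⟩, fun ⟨hf, hg, h⟩ => ?_⟩
  exact { exact := h, mono_f := hf, epi_g := hg }

/-! ### `Ext¹` as a cokernel -/

theorem extClass_eq_zero_iff_exists_section {C : Type u} [Category.{v} C] [Abelian C]
    [HasExt.{w} C] {S : ShortComplex C} (hS : S.ShortExact) :
    hS.extClass = 0 ↔ ∃ s : S.X₃ ⟶ S.X₂, s ≫ S.g = 𝟙 _ := by
  constructor
  · intro h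
    obtain ⟨x₂, hx⟩ := Abelian.Ext.covariant_sequence_exact₃ S.X₃ hS
      (Abelian.Ext.mk₀ (𝟙 S.X₃)) (zero_add 1) (by rw [h, Abelian.Ext.comp_zero])
    obtain ⟨f, rfl⟩ := Abelian.Ext.homEquiv₀.symm.surjective x₂
    refine ⟨f, Abelian.Ext.homEquiv₀.symm.injective ?_⟩
    exact (Abelian.Ext.mk₀_comp_mk₀ _ _).symm.trans hx
  · rintro ⟨s, hs⟩
    rw [← Abelian.Ext.mk₀_id_comp hS.extClass, ← hs, ← Abelian.Ext.mk₀_comp_mk₀,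
      Abelian.Ext.comp_assoc_of_second_deg_zero, ShortComplex.ShortExact.comp_extClass,
      Abelian.Ext.comp_zero]

/-- The sum of `r` copies of a representation. -/
def QRep.pow (X : QRep k I) (r : ℕ) : QRep k I where
  V i := Fin r → X.V i
  map a := LinearMap.pi fun b => X.map a ∘ₗ LinearMap.proj b

/-- The projections of a sum of copies of a representation. -/
def QRep.powProj (X : QRep k I) {r : ℕ} (b : Fin r) : QRep.Fam (X.pow r) X :=
  fun i => LinearMap.proj (φ := fun _ => X.V i) b

/-- The homomorphism from a representation to a sum of copies of it given by a vector of
scalars. -/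
def QRep.toPow (X : QRep k I) {r : ℕ} (v : Fin r → k) :
    QRep.Fam X (X.pow r) :=
  fun _ => LinearMap.pi fun b => v b • LinearMap.id

theorem QRep.toPow_mem (X : QRep k I) {r : ℕ} (v : Fin r → k) :
    X.toPow v ∈ QRep.Hom X (X.pow r) := by
  rw [QRep.mem_Hom]
  intro i j a x
  funext b
  exact ((X.map a).map_smul (v b) x).symm

namespace Rep

variable {M N : Rep k I}

/-- The short exact sequence `0 → N → E → M → 0` of an extension with a given cocycle. -/
noncomputable def extSeq (c : QRep.Cochain M.toQ N.toQ) : ShortComplex (Rep k I) where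
  X₁ := N
  X₂ := (QRep.extension c).toRep
  X₃ := M
  f := homMk (N := (QRep.extension c).toRep) (QRep.extension.inl_mem c)
  g := homMk (M := (QRep.extension c).toRep) (QRep.extension.snd_mem c)
  zero := rfl

theorem extSeq_shortExact (c : QRep.Cochain M.toQ N.toQ) : (extSeq c).ShortExact := by
  rw [shortExact_iff]
  refine ⟨fun i x y h => ?_, fun i x => ⟨QRep.extension.inr c i x, rfl⟩, fun i x h =>
    ⟨QRep.extension.fst c i x, ?_⟩⟩
  · exact congrArg (QRep.extension.fst c i) h
  · exact QRep.extension.ext rfl h.symm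

/-- Every class in `Ext¹(M, N)` is the class of an extension given by a cocycle: by effaceability it
is pushed forward from some short exact sequence ending in `M`, and such a sequence splits at each
vertex. -/
theorem exists_extClass_eq (e : Ext1 M N) :
    ∃ c : QRep.Cochain M.toQ N.toQ, (extSeq_shortExact c).extClass = e := by
  obtain ⟨P, p, hp, hpe⟩ := exists_epi_mk₀_comp_eq_zero (n := 0) e
  let S := ShortComplex.mk (Limits.kernel.ι p) p (Limits.kernel.condition p)
  have hS : S.ShortExact := { exact := ShortComplex.exact_kernel p }
  obtain ⟨x₀, hx⟩ := Abelian.Ext.contravariant_sequence_exact₃ hS N e hpe (add_zero 1)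
  obtain ⟨x, rfl⟩ := Abelian.Ext.homEquiv₀.symm.surjective x₀
  obtain ⟨hinj, hsurj, hex⟩ := (shortExact_iff S).1 hS
  choose ρ hρ using fun i => (homFam S.f i).exists_leftInverse_of_injective
    (LinearMap.ker_eq_bot.2 (hinj i))
  choose σ hσ using fun i => (homFam S.g i).exists_rightInverse_of_surjective
    (LinearMap.range_eq_top.2 (hsurj i))
  replace hρ : ∀ i y, ρ i (homFam S.f i y) = y := fun i y => LinearMap.congr_fun (hρ i) y
  replace hσ : ∀ i y, homFam S.g i (σ i y) = y := fun i y => LinearMap.congr_fun (hσ i) y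
  let ξ : QRep.Fam S.X₁.toQ N.toQ := homFam x
  have hξ : ξ ∈ QRep.Hom S.X₁.toQ N.toQ := homFam_mem x
  let g : QRep.Cochain S.X₂.toQ N.toQ := fun i j a =>
    ξ j ∘ₗ ρ j ∘ₗ S.X₂.toQ.map a - N.toQ.map a ∘ₗ ξ i ∘ₗ ρ i
  have hgdef : ∀ i j a y, g i j a y = ξ j (ρ j (S.X₂.toQ.map a y)) - N.toQ.map a (ξ i (ρ i y)) :=
    fun i j a y => rfl
  have hgι : ∀ i j a y, g i j a (homFam S.f i y) = 0 := by
    intro i j a y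
    rw [hgdef, ← QRep.mem_Hom.1 (homFam_mem S.f), hρ, hρ, QRep.mem_Hom.1 hξ, sub_self]
  have hgσ : ∀ i j a y, g i j a (σ i (homFam S.g i y)) = g i j a y := by
    intro i j a y
    obtain ⟨z, hz⟩ := hex i (y - σ i (homFam S.g i y)) (by rw [map_sub, hσ, sub_self])
    have := hgι i j a z
    rw [hz, map_sub, sub_eq_zero] at this
    exact this.symm
  let c : QRep.Cochain M.toQ N.toQ := fun i j a => g i j a ∘ₗ σ i
  let τ : QRep.Fam S.X₂.toQ (QRep.extension c) :=
    (QRep.extension.inl c).comp (ξ.comp ρ) + (QRep.extension.inr c).comp (homFam S.g)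
  have hfst : ∀ i y, QRep.extension.fst c i (τ i y) = ξ i (ρ i y) := fun i y => by simp [τ]
  have hsnd : ∀ i y, QRep.extension.snd c i (τ i y) = homFam S.g i y := fun i y => by simp [τ]
  have hτ : τ ∈ QRep.Hom S.X₂.toQ (QRep.extension c) := by
    rw [QRep.mem_Hom]
    intro i j a y
    refine QRep.extension.ext ?_ ?_
    · rw [QRep.extension.fst_map, hfst, hfst, hsnd, sub_eq_iff_eq_add'.1 (hgdef i j a y).symm,
        ← hgσ]
      rfl
    · rw [QRep.extension.snd_map, hsnd, hsnd]
      exact QRep.mem_Hom.1 (homFam_mem S.g) a y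
  let φ : S ⟶ extSeq c :=
    { τ₁ := x
      τ₂ := homMk (N := (QRep.extension c).toRep) hτ
      τ₃ := 𝟙 M
      comm₁₂ := by
        apply hom_ext
        refine QRep.Fam.ext' fun i y => QRep.extension.ext ?_ ?_
        · exact ((hfst i _).trans (congrArg (ξ i) (hρ i y))).symm
        · refine Eq.symm ((hsnd i _).trans ?_)
          exact LinearMap.congr_fun (congrFun (congrArg homFam S.zero) i) y
      comm₂₃ := by
        apply hom_ext
        exact QRep.Fam.ext' fun i y => hsnd i y }
  refine ⟨c, ?_⟩
  have := ShortComplex.ShortExact.extClass_naturality hS (extSeq_shortExact c) φ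
  rw [← hx]
  exact ((Abelian.Ext.mk₀_id_comp _).symm.trans this.symm)

/-- An extension given by a cocycle has trivial class if and only if the cocycle is in the image
of `δ`. -/
theorem extClass_eq_zero_iff (c : QRep.Cochain M.toQ N.toQ) :
    (extSeq_shortExact c).extClass = 0 ↔ c ∈ LinearMap.range (QRep.δ M.toQ N.toQ) := by
  rw [extClass_eq_zero_iff_exists_section]
  constructor
  · rintro ⟨f, hf⟩
    exact QRep.extension.mem_range_δ_of_section (homFam_mem f) (congrArg homFam hf)
  · intro h
    obtain ⟨f, hf, hfs⟩ := QRep.extension.exists_section_of_mem_range_δ h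
    exact ⟨homMk (N := (QRep.extension c).toRep) hf, hom_ext hfs⟩

/-- The morphisms from a representation to a sum of copies of it given by vectors of scalars. -/
noncomputable def toPow (M : Rep k I) (r : ℕ) : (Fin r → k) →ₗ[k] (M ⟶ (M.toQ.pow r).toRep) where
  toFun v := homMk (N := (M.toQ.pow r).toRep) (M.toQ.toPow_mem v)
  map_add' v w := hom_ext (QRep.Fam.ext' fun i x => funext fun b =>
    add_smul (v b) (w b) (show M.toQ.V i from x))
  map_smul' c v := hom_ext (QRep.Fam.ext' fun i x => funext fun b =>
    mul_smul c (v b) (show M.toQ.V i from x))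

/-- `Ext¹` is finite-dimensional: all extensions of `M` by `N` are pullbacks of one extension of a
power of `M` by `N`, whose cocycle is made of a basis of the space of cocycles. -/
theorem finite_ext1 [Finite I] [∀ i j : I, Finite (i ⟶ j)] (M N : Rep k I) :
    Module.Finite k (Ext1 M N) := by
  let r := Module.finrank k (QRep.Cochain M.toQ N.toQ)
  let b : Module.Basis (Fin r) k (QRep.Cochain M.toQ N.toQ) := Module.finBasis k _
  let M' : Rep k I := (M.toQ.pow r).toRep
  let ω : QRep.Cochain M'.toQ N.toQ := fun i j a => ∑ n, b n i j a ∘ₗ M.toQ.powProj n i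
  let κ : Ext1 M' N := (extSeq_shortExact ω).extClass
  let Λ : (Fin r → k) →ₗ[k] Ext1 M N :=
    { toFun := fun v => (Abelian.Ext.mk₀ (Y := M') (toPow M r v)).comp κ (zero_add 1)
      map_add' := fun v w => by rw [map_add, Abelian.Ext.mk₀_add, Abelian.Ext.add_comp]
      map_smul' := fun c v => by rw [map_smul, Abelian.Ext.mk₀_smul, Abelian.Ext.smul_comp]; rfl }
  refine Module.Finite.of_surjective Λ fun e => ?_
  obtain ⟨c, rfl⟩ := exists_extClass_eq e
  refine ⟨b.repr c, ?_⟩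
  have hωc : ∀ i j (a : i ⟶ j) (y : M.toQ.V i),
      ω i j a (homFam (toPow M r (b.repr c)) i y) = c i j a y := by
    intro i j a y
    have h1 : ω i j a (homFam (toPow M r (b.repr c)) i y) = ∑ n, b.repr c n • b n i j a y := by
      refine (LinearMap.sum_apply _ _ _).trans (Finset.sum_congr rfl fun n _ => ?_)
      exact (b n i j a).map_smul (b.repr c n) y
    rw [h1]
    conv_rhs => rw [← b.sum_repr c]
    simp
  let τ : QRep.Fam (QRep.extension c) (QRep.extension ω) :=
    (QRep.extension.inl ω).comp (QRep.extension.fst c) +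
      (QRep.extension.inr ω).comp (QRep.Fam.comp (homFam (toPow M r (b.repr c)))
        (QRep.extension.snd c))
  have hfst : ∀ i y, QRep.extension.fst ω i (τ i y) = QRep.extension.fst c i y :=
    fun i y => by simp [τ]
  have hsnd : ∀ i y, QRep.extension.snd ω i (τ i y) =
      homFam (toPow M r (b.repr c)) i (QRep.extension.snd c i y) := fun i y => by simp [τ]
  have hτ : τ ∈ QRep.Hom (QRep.extension c) (QRep.extension ω) := by
    rw [QRep.mem_Hom]
    intro i j a y
    refine QRep.extension.ext ?_ ?_
    · rw [QRep.extension.fst_map, hfst, hfst, hsnd, QRep.extension.fst_map, hωc]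
    · rw [QRep.extension.snd_map, hsnd, hsnd, QRep.extension.snd_map]
      exact QRep.mem_Hom.1 (homFam_mem _) a _
  let φ : extSeq c ⟶ extSeq ω :=
    { τ₁ := 𝟙 N
      τ₂ := homMk (M := (QRep.extension c).toRep) (N := (QRep.extension ω).toRep) hτ
      τ₃ := toPow M r (b.repr c)
      comm₁₂ := by
        apply hom_ext
        refine QRep.Fam.ext' fun i y => QRep.extension.ext ?_ ?_
        · exact (hfst i (QRep.extension.inl c i y)).symm
        · exact ((hsnd i (QRep.extension.inl c i y)).trans (map_zero _)).symm
      comm₂₃ := by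
        apply hom_ext
        exact QRep.Fam.ext' fun i y => hsnd i y }
  have := ShortComplex.ShortExact.extClass_naturality (extSeq_shortExact c) (extSeq_shortExact ω) φ
  exact this.symm.trans (Abelian.Ext.comp_mk₀_id _)

theorem subsingleton_ext1_iff (M N : Rep k I) :
    Subsingleton (Ext1 M N) ↔ QRep.ExtZero M.toQ N.toQ := by
  rw [QRep.ExtZero, ← LinearMap.range_eq_top]
  constructor
  · intro h
    rw [eq_top_iff]
    exact fun c _ => (extClass_eq_zero_iff c).1 (h.elim _ _)
  · intro h
    refine subsingleton_of_forall_eq 0 fun e => ?_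
    obtain ⟨c, rfl⟩ := exists_extClass_eq e
    exact (extClass_eq_zero_iff c).2 (h ▸ Submodule.mem_top)

theorem finrank_ext1_eq_zero_iff [Finite I] [∀ i j : I, Finite (i ⟶ j)] (M N : Rep k I) :
    Module.finrank k (Ext1 M N) = 0 ↔ QRep.ExtZero M.toQ N.toQ := by
  have := finite_ext1 M N
  rw [Module.finrank_zero_iff, subsingleton_ext1_iff]

end Rep

end Comparison

namespace QRep

variable {k : Type u} [Field k] {I : Type v} [Quiver.{w} I]

/-! ### Subrepresentations and direct sum decompositions -/

/-- The subrepresentation formed by a family of subspaces which is stable under the arrows. -/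
def sub (F : QRep k I) (S : ∀ i, Submodule k (F.V i))
    (hS : ∀ {i j : I} (a : i ⟶ j), ∀ x ∈ S i, F.map a x ∈ S j) : QRep k I where
  V i := S i
  map a := (F.map a).restrict (hS a)

section sub

variable (F : QRep k I) (S : ∀ i, Submodule k (F.V i))
    (hS : ∀ {i j : I} (a : i ⟶ j), ∀ x ∈ S i, F.map a x ∈ S j)

/-- The inclusion of a subrepresentation. -/
def sub.incl : Fam (F.sub S hS) F := fun i => (S i).subtype

theorem sub.incl_mem : sub.incl F S hS ∈ Hom (F.sub S hS) F := by
  rw [mem_Hom]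
  intro i j a x
  rfl

theorem sub.incl_injective (i : I) : Function.Injective (sub.incl F S hS i) :=
  Subtype.val_injective

/-- A family with values in a subrepresentation. -/
def sub.lift {M : QRep k I} (f : Fam M F) (hf : ∀ i x, f i x ∈ S i) : Fam M (F.sub S hS) :=
  fun i => (f i).codRestrict (S i) (hf i)

variable {F S}

theorem sub.incl_lift {M : QRep k I} (f : Fam M F) (hf : ∀ i x, f i x ∈ S i) :
    (sub.incl F S hS).comp (sub.lift F S hS f hf) = f := rfl

theorem sub.lift_mem {M : QRep k I} {f : Fam M F} (hfm : f ∈ Hom M F) (hf : ∀ i x, f i x ∈ S i) :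
    sub.lift F S hS f hf ∈ Hom M (F.sub S hS) := by
  rw [mem_Hom] at *
  intro i j a x
  exact Subtype.ext (hfm a x)

end sub

/-- A family whose composition with an injective family vanishes is zero; more generally, injective
families are left cancellable. -/
theorem Fam.cancel_left {L M N : QRep k I} {g : Fam M N} (hg : ∀ i, Function.Injective (g i))
    {f f' : Fam L M} (h : g.comp f = g.comp f') : f = f' :=
  Fam.ext' fun i x => hg i (LinearMap.congr_fun (congrFun h i) x)

/-- The data of a direct sum decomposition `F = A ⊕ B`. -/
structure Decomp (F A B : QRep k I) where
  /-- The inclusion of the first summand. -/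
  iA : Fam A F
  /-- The projection onto the first summand. -/
  pA : Fam F A
  /-- The inclusion of the second summand. -/
  iB : Fam B F
  /-- The projection onto the second summand. -/
  pB : Fam F B
  iA_mem : iA ∈ Hom A F
  pA_mem : pA ∈ Hom F A
  iB_mem : iB ∈ Hom B F
  pB_mem : pB ∈ Hom F B
  pA_iA : pA.comp iA = Fam.id A
  pB_iB : pB.comp iB = Fam.id B
  pA_iB : pA.comp iB = 0
  pB_iA : pB.comp iA = 0
  total : iA.comp pA + iB.comp pB = Fam.id F

theorem injective_of_retract {A F : QRep k I} {i : Fam A F} {p : Fam F A}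
    (h : p.comp i = Fam.id A) (j : I) : Function.Injective (i j) :=
  Function.LeftInverse.injective (g := p j) fun x => LinearMap.congr_fun (congrFun h j) x

theorem surjective_of_retract {A F : QRep k I} {i : Fam A F} {p : Fam F A}
    (h : p.comp i = Fam.id A) (j : I) : Function.Surjective (p j) :=
  Function.RightInverse.surjective (g := i j) fun x => LinearMap.congr_fun (congrFun h j) x

/-- `A` is isomorphic to a direct summand of `F`. -/
def IsRetract (A F : QRep k I) : Prop :=
  ∃ i ∈ Hom A F, ∃ p ∈ Hom F A, p.comp i = Fam.id A

theorem IsRetract.extZero {A B M N : QRep k I} (hA : IsRetract A M) (hB : IsRetract B N)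
    (h : ExtZero M N) : ExtZero A B := by
  obtain ⟨i, hi, p, hp, hpi⟩ := hA
  obtain ⟨i', hi', p', hp', hpi'⟩ := hB
  exact (h.of_injective hi (injective_of_retract hpi)).of_surjective hp'
    (surjective_of_retract hpi')

theorem IsRetract.refl (M : QRep k I) : IsRetract M M :=
  ⟨Fam.id M, Hom.id M, Fam.id M, Hom.id M, rfl⟩

theorem IsRetract.trans {L M N : QRep k I} (h : IsRetract L M) (h' : IsRetract M N) :
    IsRetract L N := by
  obtain ⟨i, hi, p, hp, hpi⟩ := h
  obtain ⟨i', hi', p', hp', hpi'⟩ := h'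
  refine ⟨i'.comp i, Hom.comp hi' hi, p.comp p', Hom.comp hp hp', ?_⟩
  rw [Fam.comp_assoc, ← Fam.comp_assoc p', hpi', Fam.id_comp, hpi]

theorem IsRetract.dim_le {X Y : QRep k I} (h : IsRetract X Y) : X.dim ≤ Y.dim := by
  obtain ⟨i, -, p, -, hpi⟩ := h
  exact fun j => Nat.cast_le.2 (LinearMap.finrank_le_finrank_of_injective
    (injective_of_retract hpi j))

namespace Decomp

variable {F A B : QRep k I}

theorem isRetract_left (D : Decomp F A B) : IsRetract A F :=
  ⟨D.iA, D.iA_mem, D.pA, D.pA_mem, D.pA_iA⟩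

/-- The decomposition with the two summands exchanged. -/
def symm (D : Decomp F A B) : Decomp F B A where
  iA := D.iB
  pA := D.pB
  iB := D.iA
  pB := D.pA
  iA_mem := D.iB_mem
  pA_mem := D.pB_mem
  iB_mem := D.iA_mem
  pB_mem := D.pA_mem
  pA_iA := D.pB_iB
  pB_iB := D.pA_iA
  pA_iB := D.pB_iA
  pB_iA := D.pA_iB
  total := by rw [add_comm, D.total]

theorem isRetract_right (D : Decomp F A B) : IsRetract B F := D.symm.isRetract_left

theorem dim_eq (D : Decomp F A B) : F.dim = A.dim + B.dim := by
  funext i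
  have e : F.V i ≃ₗ[k] A.V i × B.V i :=
    LinearEquiv.ofLinearMap ((D.pA i).prod (D.pB i)) ((D.iA i).coprod (D.iB i))
      (by
        have h1 := congrFun D.pA_iA i
        have h2 := congrFun D.pA_iB i
        have h3 := congrFun D.pB_iA i
        have h4 := congrFun D.pB_iB i
        simp only [Fam.comp] at h1 h2 h3 h4
        apply LinearMap.prod_ext
        · ext x
          · exact LinearMap.congr_fun
              (f := D.pA i ∘ₗ (D.iA i).coprod (D.iB i) ∘ₗ LinearMap.inl k _ _)
              (by rw [LinearMap.coprod_inl]; exact h1) x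
          · exact LinearMap.congr_fun
              (f := D.pB i ∘ₗ (D.iA i).coprod (D.iB i) ∘ₗ LinearMap.inl k _ _)
              (by rw [LinearMap.coprod_inl]; exact h3) x
        · ext x
          · exact LinearMap.congr_fun
              (f := D.pA i ∘ₗ (D.iA i).coprod (D.iB i) ∘ₗ LinearMap.inr k _ _)
              (by rw [LinearMap.coprod_inr]; exact h2) x
          · exact LinearMap.congr_fun
              (f := D.pB i ∘ₗ (D.iA i).coprod (D.iB i) ∘ₗ LinearMap.inr k _ _)
              (by rw [LinearMap.coprod_inr]; exact h4) x)
      (by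
        ext x
        exact LinearMap.congr_fun (congrFun D.total i) x)
  simp [dim, e.finrank_eq, Module.finrank_prod]

theorem homDim_right [Finite I] (D : Decomp F A B) (X : QRep k I) :
    homDim X F = homDim X A + homDim X B := by
  have e : Hom X F ≃ₗ[k] Hom X A × Hom X B :=
    LinearEquiv.ofLinearMap ((Hom.postcomp X D.pA_mem).prod (Hom.postcomp X D.pB_mem))
      ((Hom.postcomp X D.iA_mem).coprod (Hom.postcomp X D.iB_mem))
      (by
        refine LinearMap.ext fun ⟨f, g⟩ => Prod.ext (Subtype.ext ?_) (Subtype.ext ?_)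
        · change D.pA.comp (D.iA.comp f.1 + D.iB.comp g.1) = f.1
          rw [Fam.comp_add, ← Fam.comp_assoc, ← Fam.comp_assoc, D.pA_iA, D.pA_iB]
          simp
        · change D.pB.comp (D.iA.comp f.1 + D.iB.comp g.1) = g.1
          rw [Fam.comp_add, ← Fam.comp_assoc, ← Fam.comp_assoc, D.pB_iA, D.pB_iB]
          simp)
      (by
        refine LinearMap.ext fun f => Subtype.ext ?_
        change (D.iA.comp (D.pA.comp f.1) + D.iB.comp (D.pB.comp f.1)) = f.1
        rw [← Fam.comp_assoc, ← Fam.comp_assoc, ← Fam.add_comp, D.total, Fam.id_comp])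
  simp [homDim, e.finrank_eq, Module.finrank_prod]

theorem homDim_left [Finite I] (D : Decomp F A B) (X : QRep k I) :
    homDim F X = homDim A X + homDim B X := by
  have e : Hom F X ≃ₗ[k] Hom A X × Hom B X :=
    LinearEquiv.ofLinearMap ((Hom.precomp X D.iA_mem).prod (Hom.precomp X D.iB_mem))
      ((Hom.precomp X D.pA_mem).coprod (Hom.precomp X D.pB_mem))
      (by
        refine LinearMap.ext fun ⟨f, g⟩ => Prod.ext (Subtype.ext ?_) (Subtype.ext ?_)
        · change (f.1.comp D.pA + g.1.comp D.pB).comp D.iA = f.1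
          rw [Fam.add_comp, Fam.comp_assoc, Fam.comp_assoc, D.pA_iA, D.pB_iA]
          simp
        · change (f.1.comp D.pA + g.1.comp D.pB).comp D.iB = g.1
          rw [Fam.add_comp, Fam.comp_assoc, Fam.comp_assoc, D.pA_iB, D.pB_iB]
          simp)
      (by
        refine LinearMap.ext fun f => Subtype.ext ?_
        change (f.1.comp D.iA).comp D.pA + (f.1.comp D.iB).comp D.pB = f.1
        rw [Fam.comp_assoc, Fam.comp_assoc, ← Fam.comp_add, D.total, Fam.comp_id])
  simp [homDim, e.finrank_eq, Module.finrank_prod]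

end Decomp

theorem rigid_of_decomp [Fintype I] [∀ i j : I, Finite (i ⟶ j)] {F A B : QRep k I}
    (D : Decomp F A B) (hA : Rigid A) (hB : Rigid B) (hAB : ExtZero A B) (hBA : ExtZero B A) :
    Rigid F := by
  have hA' := (extZero_iff _ _).1 hA
  have hB' := (extZero_iff _ _).1 hB
  rw [extZero_iff] at hAB hBA
  rw [Rigid, extZero_iff, D.homDim_right, D.homDim_left, D.homDim_left, D.dim_eq]
  simp only [euler_add_left, euler_add_right]
  linarith

theorem extZero_decomp_right [Fintype I] [∀ i j : I, Finite (i ⟶ j)] {F A B X : QRep k I}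
    (D : Decomp F A B) (hA : ExtZero X A) (hB : ExtZero X B) : ExtZero X F := by
  rw [extZero_iff] at *
  rw [D.homDim_right, D.dim_eq, euler_add_right]
  linarith

theorem extZero_decomp_left [Fintype I] [∀ i j : I, Finite (i ⟶ j)] {F A B X : QRep k I}
    (D : Decomp F A B) (hA : ExtZero A X) (hB : ExtZero B X) : ExtZero F X := by
  rw [extZero_iff] at *
  rw [D.homDim_left, D.dim_eq, euler_add_left]
  linarith

theorem Fam.id_sub_comp_self {F : QRep k I} {e : Fam F F} (hee : e.comp e = e) :
    (Fam.id F - e).comp (Fam.id F - e) = Fam.id F - e := by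
  refine Fam.ext' fun i x => ?_
  have : e i (e i x) = e i x := LinearMap.congr_fun (congrFun hee i) x
  simp [this]

/-- An idempotent endomorphism decomposes a representation into its image and the image of the
complementary idempotent. -/
theorem exists_decomp_of_idempotent {F : QRep k I} {e : Fam F F} (he : e ∈ Hom F F)
    (hee : e.comp e = e) :
    ∃ (A B : QRep k I) (D : Decomp F A B), D.iA.comp D.pA = e := by
  have hS : ∀ {g : Fam F F}, g ∈ Hom F F → ∀ {i j : I} (a : i ⟶ j),
      ∀ x ∈ LinearMap.range (g i), F.map a x ∈ LinearMap.range (g j) := by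
    rintro g hg i j a _ ⟨x, rfl⟩
    exact ⟨F.map a x, mem_Hom.1 hg a x⟩
  have he' : Fam.id F - e ∈ Hom F F := sub_mem (Hom.id F) he
  have hee' : (Fam.id F - e).comp (Fam.id F - e) = Fam.id F - e := by
    exact Fam.id_sub_comp_self hee
  have h1 : e.comp (Fam.id F - e) = 0 := by rw [Fam.comp_sub, hee]; simp
  have h2 : (Fam.id F - e).comp e = 0 := by rw [Fam.sub_comp, hee]; simp
  refine ⟨F.sub (fun i => LinearMap.range (e i)) (hS he),
    F.sub (fun i => LinearMap.range ((Fam.id F - e) i)) (hS he'),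
    { iA := sub.incl _ _ _
      pA := sub.lift _ _ _ e fun i x => ⟨x, rfl⟩
      iB := sub.incl _ _ _
      pB := sub.lift _ _ _ (Fam.id F - e) fun i x => ⟨x, rfl⟩
      iA_mem := sub.incl_mem _ _ _
      pA_mem := sub.lift_mem _ he _
      iB_mem := sub.incl_mem _ _ _
      pB_mem := sub.lift_mem _ he' _
      pA_iA := ?_, pB_iB := ?_, pA_iB := ?_, pB_iA := ?_, total := ?_ }, sub.incl_lift _ _ _⟩
  · refine Fam.ext' fun i ⟨_, x, hx⟩ => Subtype.ext ?_
    subst hx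
    exact LinearMap.congr_fun (congrFun hee i) x
  · refine Fam.ext' fun i ⟨_, x, hx⟩ => Subtype.ext ?_
    subst hx
    exact LinearMap.congr_fun (congrFun hee' i) x
  · refine Fam.ext' fun i ⟨_, x, hx⟩ => Subtype.ext ?_
    subst hx
    exact LinearMap.congr_fun (congrFun h1 i) x
  · refine Fam.ext' fun i ⟨_, x, hx⟩ => Subtype.ext ?_
    subst hx
    exact LinearMap.congr_fun (congrFun h2 i) x
  · refine Fam.ext' fun i x => ?_
    change e i x + (x - e i x) = x
    abel

/-- A direct summand has a complement. -/
theorem IsRetract.exists_decomp {A F : QRep k I} {i : Fam A F} {p : Fam F A}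
    (hi : i ∈ Hom A F) (hp : p ∈ Hom F A) (h : p.comp i = Fam.id A) :
    ∃ (B : QRep k I) (D : Decomp F A B), D.iA = i ∧ D.pA = p := by
  obtain ⟨B, C, D, hD⟩ := exists_decomp_of_idempotent
    (e := Fam.id F - i.comp p) (sub_mem (Hom.id F) (Hom.comp hi hp)) (by
      have : (i.comp p).comp (i.comp p) = i.comp p := by
        rw [Fam.comp_assoc, ← Fam.comp_assoc p, h, Fam.id_comp]
      exact Fam.id_sub_comp_self this)
  have h1 : p.comp D.iA = 0 := by
    have : (p.comp D.iA).comp D.pA = 0 := by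
      rw [Fam.comp_assoc, hD, Fam.comp_sub, ← Fam.comp_assoc, h]
      simp
    have := congrArg (fun f => f.comp D.iA) this
    simpa [Fam.comp_assoc, D.pA_iA] using this
  have h2 : D.pA.comp i = 0 := by
    have : D.iA.comp (D.pA.comp i) = 0 := by
      rw [← Fam.comp_assoc, hD, Fam.sub_comp, Fam.comp_assoc, h]
      simp
    have := congrArg (fun f => D.pA.comp f) this
    simpa [← Fam.comp_assoc, D.pA_iA] using this
  exact ⟨B, ⟨i, p, D.iA, D.pA, hi, hp, D.iA_mem, D.pA_mem, h, D.pA_iA, h1, h2, by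
    rw [hD]; simp⟩, rfl, rfl⟩

/-! ### Indecomposable representations -/

/-- A representation is indecomposable if it is nonzero and its only idempotent endomorphisms are
`0` and the identity. -/
def Indec (X : QRep k I) : Prop :=
  Fam.id X ≠ 0 ∧ ∀ e ∈ Hom X X, e.comp e = e → e = 0 ∨ e = Fam.id X

/-- The total dimension. -/
noncomputable def size [Fintype I] (X : QRep k I) : ℕ := ∑ i, Module.finrank k (X.V i)

theorem Decomp.size_eq [Fintype I] {F A B : QRep k I} (D : Decomp F A B) :
    F.size = A.size + B.size := by
  rw [size, size, size, ← Finset.sum_add_distrib]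
  refine Finset.sum_congr rfl fun i _ => ?_
  have := congrFun D.dim_eq i
  simp only [dim, Pi.add_apply] at this
  exact_mod_cast this

theorem id_eq_zero_iff {X : QRep k I} : Fam.id X = 0 ↔ X.dim = 0 := by
  constructor
  · intro h
    funext i
    have : Subsingleton (X.V i) := subsingleton_of_forall_eq 0 fun x =>
      LinearMap.congr_fun (congrFun h i) x
    simp [dim, Module.finrank_zero_of_subsingleton]
  · intro h
    refine Fam.ext' fun i x => ?_
    have := congrFun h i
    have : Subsingleton (X.V i) := by
      rw [← Module.finrank_zero_iff (R := k)]
      simpa [dim] using this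
    exact Subsingleton.elim _ _

theorem size_eq_zero_iff [Fintype I] {X : QRep k I} : X.size = 0 ↔ Fam.id X = 0 := by
  rw [id_eq_zero_iff, size, Finset.sum_eq_zero_iff, funext_iff]
  simp [dim]

/-- A representation is zero, or indecomposable, or the direct sum of two nonzero ones. -/
theorem zero_or_indec_or_decomp (X : QRep k I) : Fam.id X = 0 ∨ Indec X ∨
    ∃ (A B : QRep k I) (_ : Decomp X A B), Fam.id A ≠ 0 ∧ Fam.id B ≠ 0 := by
  by_cases h0 : Fam.id X = 0
  · exact Or.inl h0
  by_cases hI : Indec X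
  · exact Or.inr (Or.inl hI)
  refine Or.inr (Or.inr ?_)
  simp only [Indec, not_and, not_forall] at hI
  obtain ⟨e, he, hee, hne⟩ := hI h0
  rw [not_or] at hne
  obtain ⟨A, B, D, hD⟩ := exists_decomp_of_idempotent he hee
  refine ⟨A, B, D, fun hA => hne.1 ?_, fun hB => hne.2 ?_⟩
  · rw [← hD, ← Fam.comp_id D.iA, hA]
    simp
  · rw [← D.total, ← Fam.comp_id D.iB, hB, hD]
    simp

theorem extZero_of_id_eq_zero_left {X Y : QRep k I} (h : Fam.id X = 0) : ExtZero X Y := by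
  intro c
  refine ⟨0, ?_⟩
  funext i j a
  ext x
  have : x = 0 := LinearMap.congr_fun (congrFun h i) x
  simp [this]

theorem extZero_of_id_eq_zero_right {X Y : QRep k I} (h : Fam.id Y = 0) : ExtZero X Y := by
  intro c
  refine ⟨0, ?_⟩
  funext i j a
  ext x
  have : c i j a x = 0 := LinearMap.congr_fun (congrFun h j) (c i j a x)
  simp [this]

end QRep

/-! ### Indecomposable representations are rigid bricks -/

open Polynomial in
/-- In a finite-dimensional algebra over an algebraically closed field whose only idempotents are
`0` and `1`, every element is the sum of a scalar and a nilpotent element. -/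
theorem exists_isNilpotent_sub {k A : Type*} [Field k] [IsAlgClosed k] [Ring A] [Algebra k A]
    [Nontrivial A] [FiniteDimensional k A] (h : ∀ e : A, e * e = e → e = 0 ∨ e = 1) (a : A) :
    ∃ c : k, IsNilpotent (a - algebraMap k A c) := by
  have hint : IsIntegral k a := Algebra.IsIntegral.isIntegral a
  set p := minpoly k a with hp
  have hp0 : p ≠ 0 := minpoly.ne_zero hint
  obtain ⟨c, hc⟩ := IsAlgClosed.exists_root p (minpoly.degree_pos hint).ne'
  obtain ⟨q, hpq, hq⟩ := Polynomial.exists_eq_pow_rootMultiplicity_mul_and_not_dvd p hp0 c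
  set m := p.rootMultiplicity c
  have hcop : IsCoprime ((X - C c) ^ m) q :=
    IsCoprime.pow_left ((Polynomial.irreducible_X_sub_C c).coprime_iff_not_dvd.2 hq)
  obtain ⟨u, v, huv⟩ := hcop
  have hdvd : ∀ r : k[X], aeval a r = 0 ↔ p ∣ r := fun r => (minpoly.dvd_iff).symm
  have hroot : X - C c ∣ p := Polynomial.dvd_iff_isRoot.2 hc
  have hsum : aeval a (u * (X - C c) ^ m) + aeval a (v * q) = 1 := by
    rw [← map_add, huv, map_one]
  -- the idempotent of the primary decomposition of `k[a]` which belongs to the root `c`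
  have hid : aeval a (v * q) * aeval a (v * q) = aeval a (v * q) := by
    have h0 : aeval a (u * (X - C c) ^ m) * aeval a (v * q) = 0 := by
      rw [← map_mul, hdvd, hpq]
      exact ⟨u * v, by ring⟩
    have := congrArg (fun x => x * aeval a (v * q)) hsum
    rwa [add_mul, h0, zero_add, one_mul] at this
  rcases h _ hid with h0 | h1
  · exfalso
    have h2 : X - C c ∣ v * q := hroot.trans ((hdvd _).1 h0)
    have hm : 0 < m := (Polynomial.rootMultiplicity_pos hp0).2 hc
    have h3 : X - C c ∣ u * (X - C c) ^ m := (dvd_pow_self _ hm.ne').mul_left u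
    exact (Polynomial.irreducible_X_sub_C c).not_isUnit (isUnit_of_dvd_one (huv ▸ dvd_add h3 h2))
  · refine ⟨c, m, ?_⟩
    rw [h1, add_eq_right] at hsum
    have h2 : q ∣ u * (X - C c) ^ m := (Dvd.intro_left _ hpq.symm).trans ((hdvd _).1 hsum)
    obtain ⟨w, hw⟩ : IsUnit q := isUnit_of_dvd_one (huv ▸ dvd_add h2 (dvd_mul_left q v))
    have h4 : aeval a ((X - C c) ^ m) = 0 := by
      rw [hdvd, hpq]
      exact ⟨↑w⁻¹, by rw [← hw, mul_assoc, Units.mul_inv, mul_one]⟩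
    simpa using h4

namespace QRep

variable {k : Type u} [Field k] {I : Type v} [Quiver.{w} I]

/-- The endomorphism algebra. -/
def endAlg (X : QRep k I) : Subalgebra k (∀ i, Module.End k (X.V i)) where
  carrier := {f | f ∈ Hom X X}
  mul_mem' := fun hf hg => Hom.comp hf hg
  add_mem' := fun hf hg => (Hom X X).add_mem hf hg
  algebraMap_mem' := fun c => by
    rw [Algebra.algebraMap_eq_smul_one]
    exact Submodule.smul_mem _ c (Hom.id X)

/-- An indecomposable representation over an algebraically closed field has only scalar
endomorphisms, or a nonzero endomorphism of square zero. -/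
theorem Indec.scalar_or_exists_sq_zero [Finite I] [IsAlgClosed k] {X : QRep k I} (hX : Indec X) :
    (∀ f ∈ Hom X X, ∃ c : k, f = c • Fam.id X) ∨
      ∃ θ ∈ Hom X X, θ ≠ 0 ∧ θ.comp θ = 0 := by
  by_contra! hcon
  obtain ⟨⟨f, hf, hfc⟩, hθ⟩ := hcon
  have : Nontrivial X.endAlg := ⟨⟨1, 0, fun h => hX.1 (congrArg Subtype.val h)⟩⟩
  have : FiniteDimensional k X.endAlg :=
    FiniteDimensional.finiteDimensional_submodule (Subalgebra.toSubmodule X.endAlg)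
  obtain ⟨c, hc⟩ := exists_isNilpotent_sub (k := k) (A := X.endAlg) (fun e he => by
    rcases hX.2 e.1 e.2 (congrArg Subtype.val he) with h | h
    · exact Or.inl (Subtype.ext h)
    · exact Or.inr (Subtype.ext h)) ⟨f, hf⟩
  have hred : IsReduced X.endAlg := by
    rw [isReduced_iff_pow_one_lt 2 (by norm_num)]
    intro θ h
    by_contra hne
    refine hθ θ.1 θ.2 (fun h0 => hne (Subtype.ext h0)) ?_
    rw [pow_two] at h
    exact congrArg Subtype.val h
  have h0 := hc.eq_zero
  rw [sub_eq_zero, Algebra.algebraMap_eq_smul_one] at h0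
  exact hfc c (congrArg Subtype.val h0)

/-- The sum over the vertices of the ranks of the linear maps of a family. -/
noncomputable def Fam.rank [Fintype I] {M N : QRep k I} (f : Fam M N) : ℕ :=
  ∑ i, Module.finrank k (LinearMap.range (f i))

theorem Fam.rank_comp_le [Fintype I] {L M N : QRep k I} (g : Fam M N) (f : Fam L M) :
    (g.comp f).rank ≤ f.rank := by
  refine Finset.sum_le_sum fun i _ => ?_
  change Module.finrank k (LinearMap.range (g i ∘ₗ f i)) ≤ _
  rw [LinearMap.range_comp]
  exact Submodule.finrank_map_le _ _

/-- A family which does not lower the rank is injective on the image. -/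
theorem Fam.eq_zero_of_rank_comp [Fintype I] {L M N : QRep k I} {g : Fam M N} {f : Fam L M}
    (h : f.rank ≤ (g.comp f).rank) (i : I) (x : L.V i) (hx : g i (f i x) = 0) : f i x = 0 := by
  have hle : ∀ i ∈ Finset.univ, Module.finrank k (LinearMap.range ((g.comp f) i)) ≤
      Module.finrank k (LinearMap.range (f i)) := by
    intro i _
    change Module.finrank k (LinearMap.range (g i ∘ₗ f i)) ≤ _
    rw [LinearMap.range_comp]
    exact Submodule.finrank_map_le _ _
  have heq := (Finset.sum_eq_sum_iff_of_le hle).1 (le_antisymm (g.rank_comp_le f) h) i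
    (Finset.mem_univ i)
  let r : LinearMap.range (f i) →ₗ[k] N.V i := g i ∘ₗ (LinearMap.range (f i)).subtype
  have hr : LinearMap.range r = LinearMap.range ((g.comp f) i) := by
    change LinearMap.range (g i ∘ₗ _) = LinearMap.range (g i ∘ₗ f i)
    rw [LinearMap.range_comp, LinearMap.range_comp, Submodule.range_subtype]
  have hk := LinearMap.finrank_range_add_finrank_ker r
  rw [hr, heq, Nat.add_eq_left, Submodule.finrank_eq_zero] at hk
  have h2 : (⟨f i x, x, rfl⟩ : LinearMap.range (f i)) ∈ LinearMap.ker r := hx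
  rw [hk, Submodule.mem_bot] at h2
  exact congrArg Subtype.val h2

theorem size_le_of_injective [Fintype I] {M N : QRep k I} {f : Fam M N}
    (hf : ∀ i, Function.Injective (f i)) : M.size ≤ N.size :=
  Finset.sum_le_sum fun i _ => LinearMap.finrank_le_finrank_of_injective (hf i)

/-- Ringel's lemma: if the Euler form is positive, then indecomposable representations over an
algebraically closed field are bricks without self-extensions. Otherwise a nonzero endomorphism `θ`
of square zero and of minimal rank gives an indecomposable summand `A` of its kernel into which the
image of `θ` embeds, and which has self-extensions. -/
theorem Indec.rigid_and_homDim [Fintype I] [∀ i j : I, Finite (i ⟶ j)] [IsAlgClosed k]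
    (hq : ∀ d : I → ℤ, 0 ≤ d → d ≠ 0 → 1 ≤ euler d d) {X : QRep k I} (hX : Indec X) :
    Rigid X ∧ homDim X X = 1 := by
  induction hn : X.size using Nat.strong_induction_on generalizing X with
  | _ n ih =>
  subst hn
  have hend : ∀ f ∈ Hom X X, ∃ c : k, f = c • Fam.id X := by
    refine hX.scalar_or_exists_sq_zero.resolve_right fun hex => ?_
    obtain ⟨θ, ⟨hθ, hθ0, hθθ⟩, hmin⟩ := exists_minimalFor_of_wellFoundedLT
      (fun θ : Fam X X => θ ∈ Hom X X ∧ θ ≠ 0 ∧ θ.comp θ = 0) Fam.rank hex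
    let K := X.sub (fun i => LinearMap.ker (θ i)) fun {i j} a x hx => by
      rw [LinearMap.mem_ker] at *
      rw [mem_Hom.1 hθ, hx, map_zero]
    let ιK : Fam K X := sub.incl _ _ _
    have hιK : ιK ∈ Hom K X := sub.incl_mem _ _ _
    have hιKinj : ∀ i, Function.Injective (ιK i) := sub.incl_injective _ _ _
    have hιKθ : θ.comp ιK = 0 := Fam.ext' fun i x => x.2
    let θ' : Fam X K := sub.lift _ _ _ θ fun i x => LinearMap.congr_fun (congrFun hθθ i) x
    have hθ' : θ' ∈ Hom X K := sub.lift_mem _ hθ _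
    have hιθ : ιK.comp θ' = θ := rfl
    have hθ'ι : θ'.comp ιK = 0 := Fam.cancel_left hιKinj (by
      rw [← Fam.comp_assoc, hιθ, hιKθ, Fam.comp_zero])
    choose r hr using fun i => (ιK i).exists_leftInverse_of_injective
      (LinearMap.ker_eq_bot.2 (hιKinj i))
    replace hr : ∀ i y, r i (ιK i y) = y := fun i y => LinearMap.congr_fun (hr i) y
    have hθ'rank : θ'.rank ≤ θ.rank := by
      have : θ' = Fam.comp (L := X) r θ := Fam.ext' fun j x => (hr j _).symm
      rw [this]
      exact Fam.rank_comp_le (L := X) (M := X) (N := K) r θ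
    obtain ⟨A, ⟨i, hi, p, hp, hpi, hpθ⟩, hAmin⟩ := exists_minimalFor_of_wellFoundedLT
      (fun A : QRep k I => ∃ i ∈ Hom A K, ∃ p ∈ Hom K A, p.comp i = Fam.id A ∧ p.comp θ' ≠ 0) size
      ⟨K, Fam.id K, Hom.id K, Fam.id K, Hom.id K, rfl, fun h => hθ0 (by
        rw [← hιθ, ← Fam.id_comp θ', h, Fam.comp_zero])⟩
    -- minimality of `A` makes it indecomposable
    have hA0 : Fam.id A ≠ 0 := fun h => hpθ (by rw [← Fam.id_comp (p.comp θ'), h]; rfl)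
    have hA : Indec A := by
      rcases zero_or_indec_or_decomp A with h | h | ⟨A₁, A₂, D, h₁, h₂⟩
      · exact absurd h hA0
      · exact h
      · exfalso
        have key : ∀ B C (D : Decomp A B C), Fam.id C ≠ 0 → D.pA.comp (p.comp θ') = 0 := by
          intro B C D hC
          by_contra hne
          have := hAmin ⟨i.comp D.iA, Hom.comp hi D.iA_mem, D.pA.comp p, Hom.comp D.pA_mem hp, by
            rw [Fam.comp_assoc, ← Fam.comp_assoc p, hpi, Fam.id_comp, D.pA_iA], hne⟩
            (by rw [D.size_eq]; omega)
          rw [D.size_eq] at this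
          exact hC (size_eq_zero_iff.1 (by omega))
        apply hpθ
        rw [← Fam.id_comp (p.comp θ'), ← D.total, Fam.add_comp, Fam.comp_assoc, Fam.comp_assoc,
          key _ _ D h₂, show D.pB.comp (p.comp θ') = 0 from key _ _ D.symm h₁]
        simp
    -- minimality of `θ` makes `p` injective on the image of `θ`
    have hιi : ∀ j, Function.Injective ((ιK.comp i) j) := fun j =>
      (hιKinj j).comp (injective_of_retract hpi j)
    have hpinj : ∀ j x, p j (θ' j x) = 0 → θ' j x = 0 := by
      have hrank : θ.rank ≤ ((ιK.comp (i.comp p)).comp θ').rank := by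
        refine hmin ⟨Hom.comp (Hom.comp hιK (Hom.comp hi hp)) hθ', fun h => hpθ ?_, ?_⟩ ?_
        · refine Fam.cancel_left hιi ?_
          rw [Fam.comp_zero]
          exact h
        · have : θ'.comp ((ιK.comp (i.comp p)).comp θ') = 0 := by
            rw [Fam.comp_assoc, ← Fam.comp_assoc, hθ'ι, Fam.zero_comp]
          rw [Fam.comp_assoc _ θ', this, Fam.comp_zero]
        · exact (Fam.rank_comp_le _ _).trans hθ'rank
      intro j x hx
      refine Fam.eq_zero_of_rank_comp (hθ'rank.trans hrank) j x ?_
      change ιK j (i j (p j (θ' j x))) = 0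
      rw [hx, map_zero, map_zero]
    let Im := X.sub (fun j => LinearMap.range (θ j)) (by
      rintro j l a _ ⟨x, rfl⟩
      exact ⟨X.map a x, mem_Hom.1 hθ a x⟩)
    let θ'' : Fam X Im := sub.lift _ _ _ θ fun j x => ⟨x, rfl⟩
    have hθ'' : θ'' ∈ Hom X Im := sub.lift_mem _ hθ _
    have hθ''s : ∀ j, Function.Surjective (θ'' j) := by
      rintro j ⟨_, x, rfl⟩
      exact ⟨x, rfl⟩
    have hker : ∀ j x, θ'' j x = 0 → ∃ y, ιK j y = x := fun j x hx =>
      ⟨⟨x, congrArg Subtype.val hx⟩, rfl⟩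
    let ιI : Fam Im K := sub.lift _ _ _ (sub.incl X _ _) (by
      rintro j ⟨_, x, rfl⟩
      exact LinearMap.congr_fun (congrFun hθθ j) x)
    have hιI : ιI ∈ Hom Im K := sub.lift_mem _ (sub.incl_mem _ _ _) _
    have hιIθ : ιI.comp θ'' = θ' := rfl
    have hpιI : ∀ j, Function.Injective ((p.comp ιI) j) := by
      intro j
      refine (injective_iff_map_eq_zero _).2 fun y hy => ?_
      obtain ⟨x, rfl⟩ := hθ''s j y
      have h2 : θ' j x = 0 := hpinj j x hy
      exact Subtype.ext (congrArg (ιK j) h2)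
    -- otherwise the projection of the kernel onto `A` would extend to `X`
    have hnot : ¬ ExtZero Im A := by
      intro hext
      choose σ hσ using fun j => (θ'' j).exists_rightInverse_of_surjective
        (LinearMap.range_eq_top.2 (hθ''s j))
      replace hσ : ∀ j y, θ'' j (σ j y) = y := fun j y => LinearMap.congr_fun (hσ j) y
      let q : Fam X A := fun j => p j ∘ₗ r j
      have hq' : ∀ j y, q j (ιK j y) = p j y := fun j y => congrArg (p j) (hr j y)
      have hgσ : ∀ {j l : I} (a : j ⟶ l) (x : X.V j),
          δ X A q j l a (σ j (θ'' j x)) = δ X A q j l a x := by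
        intro j l a x
        obtain ⟨y, hy⟩ := hker j (x - σ j (θ'' j x)) (by rw [map_sub, hσ, sub_self])
        have : δ X A q j l a (ιK j y) = 0 := by
          rw [δ_apply, ← mem_Hom.1 hιK, hq', hq', mem_Hom.1 hp, sub_self]
        rw [hy, map_sub, sub_eq_zero] at this
        exact this.symm
      obtain ⟨f, hf⟩ := hext fun j l a => δ X A q j l a ∘ₗ σ j
      let p' : Fam X A := q - f.comp θ''
      have hp' : p' ∈ Hom X A := by
        rw [mem_Hom]
        intro j l a x
        have h1 := LinearMap.congr_fun (congrFun (congrFun (congrFun hf j) l) a) (θ'' j x)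
        rw [LinearMap.comp_apply, hgσ, δ_apply, δ_apply, ← mem_Hom.1 hθ'',
          sub_eq_sub_iff_sub_eq_sub] at h1
        change q l (X.map a x) - f l (θ'' l (X.map a x)) = A.map a (q j x - f j (θ'' j x))
        rw [map_sub, ← neg_sub, h1, neg_sub]
      have hpι : p'.comp ιK = p := by
        refine Fam.ext' fun j y => ?_
        have h0 : θ'' j (ιK j y) = 0 := Subtype.ext y.2
        change q j (ιK j y) - f j (θ'' j (ιK j y)) = p j y
        rw [h0, map_zero, sub_zero, hq']
      have hret : p'.comp (ιK.comp i) = Fam.id A := by rw [← Fam.comp_assoc, hpι, hpi]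
      rcases hX.2 ((ιK.comp i).comp p') (Hom.comp (Hom.comp hιK hi) hp') (by
        rw [Fam.comp_assoc, ← Fam.comp_assoc p', hret, Fam.id_comp]) with h | h
      · apply hA0
        calc Fam.id A = (p'.comp (ιK.comp i)).comp (p'.comp (ιK.comp i)) := by rw [hret]; rfl
          _ = p'.comp (((ιK.comp i).comp p').comp (ιK.comp i)) := rfl
          _ = 0 := by rw [h, Fam.zero_comp, Fam.comp_zero]
      · apply hθ0
        rw [← Fam.comp_id θ, ← h, ← Fam.comp_assoc, ← Fam.comp_assoc, hιKθ]
        simp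
    have hAX : A.size < X.size := by
      refine (size_le_of_injective hιi).lt_of_ne fun heq => hθ0 ?_
      have h1 := (Finset.sum_eq_sum_iff_of_le fun j _ =>
        LinearMap.finrank_le_finrank_of_injective (hιi j)).1 heq
      refine Fam.ext' fun j x => ?_
      obtain ⟨y, rfl⟩ := (LinearMap.injective_iff_surjective_of_finrank_eq_finrank
        (h1 j (Finset.mem_univ j))).1 (hιi j) x
      exact LinearMap.congr_fun (congrFun hιKθ j) (i j y)
    exact hnot ((ih A.size hAX hA rfl).1.of_injective (Hom.comp hp hιI) hpιI)
  have h1 : homDim X X = 1 := by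
    have : Module.finrank k (Hom X X) = 1 := by
      refine finrank_eq_one (⟨Fam.id X, Hom.id X⟩ : Hom X X)
        (fun h => hX.1 (congrArg Subtype.val h)) fun f => ?_
      obtain ⟨c, hc⟩ := hend f.1 f.2
      exact ⟨c, Subtype.ext hc.symm⟩
    simp [homDim, this]
  refine ⟨(extZero_iff X X).2 (le_antisymm ?_ (euler_le_homDim X X)), h1⟩
  rw [h1]
  exact hq _ X.dim_nonneg fun h => hX.1 (id_eq_zero_iff.2 h)

end QRep

namespace QRep

variable {k : Type u} [Field k] {I : Type v} [Quiver.{w} I]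

/-! ### Existence of rigid representations -/

/-- If the indecomposable representations are rigid and there are no extensions between
complementary summands of `F`, then `F` is rigid. -/
theorem rigid_of_forall_decomp [Fintype I] [∀ i j : I, Finite (i ⟶ j)]
    (hrig : ∀ X : QRep k I, Indec X → Rigid X) {F : QRep k I}
    (hF : ∀ A B : QRep k I, Decomp F A B → ExtZero A B) : Rigid F := by
  induction hn : F.size using Nat.strong_induction_on generalizing F with
  | _ n ih =>
  subst hn
  rcases zero_or_indec_or_decomp F with h | h | ⟨A, B, D, hA, hB⟩
  · exact extZero_of_id_eq_zero_left h
  · exact hrig F h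
  · have key : ∀ A B, Decomp F A B → Fam.id B ≠ 0 → Rigid A := by
      intro A B D hB
      refine ih A.size ?_ (fun A₁ A₂ D' => ?_) rfl
      · have : B.size ≠ 0 := fun h => hB (size_eq_zero_iff.1 h)
        rw [D.size_eq]
        omega
      · obtain ⟨C, D₁, hi, hp⟩ := IsRetract.exists_decomp (Hom.comp D.iA_mem D'.iA_mem)
          (Hom.comp D'.pA_mem D.pA_mem) (by
            rw [Fam.comp_assoc, ← Fam.comp_assoc D.pA, D.pA_iA, Fam.id_comp, D'.pA_iA])
        -- `A₂` is a direct summand of the complement `C` of `A₁`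
        refine (IsRetract.refl A₁).extZero ⟨D₁.pB.comp (D.iA.comp D'.iB),
          Hom.comp D₁.pB_mem (Hom.comp D.iA_mem D'.iB_mem), D'.pB.comp (D.pA.comp D₁.iB),
          Hom.comp D'.pB_mem (Hom.comp D.pA_mem D₁.iB_mem), ?_⟩ (hF A₁ C D₁)
        have h1 : D₁.iB.comp D₁.pB = Fam.id F - (D.iA.comp D'.iA).comp (D'.pA.comp D.pA) := by
          rw [← hi, ← hp, eq_sub_iff_add_eq, add_comm, D₁.total]
        calc (D'.pB.comp (D.pA.comp D₁.iB)).comp (D₁.pB.comp (D.iA.comp D'.iB))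
            = D'.pB.comp (D.pA.comp ((D₁.iB.comp D₁.pB).comp (D.iA.comp D'.iB))) := rfl
          _ = D'.pB.comp ((D.pA.comp D.iA).comp D'.iB) -
              (D'.pB.comp ((D.pA.comp D.iA).comp D'.iA)).comp
                (D'.pA.comp ((D.pA.comp D.iA).comp D'.iB)) := by
              rw [h1, Fam.sub_comp, Fam.comp_sub, Fam.comp_sub]
              rfl
          _ = Fam.id A₂ := by
              rw [D.pA_iA, Fam.id_comp, Fam.id_comp, D'.pB_iB, D'.pA_iB, D'.pB_iA]
              simp
    exact rigid_of_decomp D (key A B D hB) (key B A D.symm hA) (hF A B D) (hF B A D.symm)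

/-- A nonempty class of representations which contains the extensions of the two summands of any
direct sum decomposition of a member contains a rigid representation, namely each member with an
endomorphism algebra of minimal dimension. -/
theorem exists_rigid [Fintype I] [∀ i j : I, Finite (i ⟶ j)]
    (hrig : ∀ X : QRep k I, Indec X → Rigid X) (P : QRep k I → Prop)
    (hP : ∀ F A B : QRep k I, Decomp F A B → P F → ∀ c : Cochain A B, P (extension c))
    (hne : ∃ F, P F) : ∃ F, P F ∧ Rigid F := by
  obtain ⟨F, hF, hmin⟩ := exists_minimalFor_of_wellFoundedLT P
    (fun F => Module.finrank k (Hom F F)) hne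
  refine ⟨F, hF, rigid_of_forall_decomp hrig fun A B D => ?_⟩
  rw [ExtZero, ← LinearMap.range_eq_top]
  by_contra hne
  obtain ⟨c, -, hc⟩ := SetLike.exists_of_lt (lt_top_iff_ne_top.2 hne)
  have h1 := homDim_extension_right_lt c hc
  have h2 := homDim_extension_right_le c B
  have h3 := homDim_extension_left_le c (extension c)
  have h4 := D.homDim_right F
  have h5 := D.homDim_left A
  have h6 := D.homDim_left B
  have h7 : homDim (extension c) (extension c) < homDim F F := by linarith
  have h8 : Module.finrank k (Hom (extension c) (extension c)) < Module.finrank k (Hom F F) := by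
    simpa [homDim] using h7
  exact absurd (hmin (hP F A B D hF c) h8.le) (not_le.2 h8)

/-- The representation without nonzero maps and with spaces of given dimensions. -/
def trivialRep (k : Type u) [Field k] {I : Type v} [Quiver.{w} I] (d : I → ℕ) : QRep k I where
  V i := Fin (d i) → k
  map _ := 0

theorem dim_trivialRep (d : I → ℕ) : (trivialRep k d).dim = fun i => (d i : ℤ) := by
  funext i
  change ((Module.finrank k (Fin (d i) → k) : ℕ) : ℤ) = d i
  simp

theorem exists_dim_eq (k : Type u) [Field k] {d : I → ℤ} (hd : 0 ≤ d) :
    ∃ F : QRep k I, F.dim = d :=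
  ⟨trivialRep k fun i => (d i).toNat, by
    rw [dim_trivialRep]
    funext i
    exact Int.toNat_of_nonneg (hd i)⟩

/-! ### Uniqueness of rigid representations -/

/-- Isomorphism of representations. -/
def Iso (X Y : QRep k I) : Prop := ∃ f ∈ Hom X Y, ∀ i, Function.Bijective (f i)

theorem Iso.exists_inverse {X Y : QRep k I} (h : Iso X Y) :
    ∃ f ∈ Hom X Y, ∃ g ∈ Hom Y X, g.comp f = Fam.id X ∧ f.comp g = Fam.id Y := by
  obtain ⟨f, hf, hb⟩ := h
  let e : ∀ i, X.V i ≃ₗ[k] Y.V i := fun i => LinearEquiv.ofBijective (f i) (hb i)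
  have he : ∀ i x, e i x = f i x := fun i x => rfl
  refine ⟨f, hf, fun i => (e i).symm, ?_, Fam.ext' fun i x => (e i).symm_apply_apply x,
    Fam.ext' fun i x => (e i).apply_symm_apply x⟩
  rw [mem_Hom]
  intro i j a y
  obtain ⟨x, rfl⟩ := (e i).surjective y
  change (e j).symm (Y.map a (e i x)) = X.map a ((e i).symm (e i x))
  rw [(e i).symm_apply_apply, (e j).symm_apply_eq, he, he, mem_Hom.1 hf]

theorem Iso.symm {X Y : QRep k I} (h : Iso X Y) : Iso Y X := by
  obtain ⟨f, hf, g, hg, hgf, hfg⟩ := h.exists_inverse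
  exact ⟨g, hg, fun i => ⟨injective_of_retract hfg i, surjective_of_retract hgf i⟩⟩

theorem Iso.trans {X Y Z : QRep k I} (h : Iso X Y) (h' : Iso Y Z) : Iso X Z := by
  obtain ⟨f, hf, hb⟩ := h
  obtain ⟨g, hg, hb'⟩ := h'
  exact ⟨g.comp f, Hom.comp hg hf, fun i => (hb' i).comp (hb i)⟩

theorem Iso.isRetract {X Y : QRep k I} (h : Iso X Y) : IsRetract X Y := by
  obtain ⟨f, hf, g, hg, hgf, -⟩ := h.exists_inverse
  exact ⟨f, hf, g, hg, hgf⟩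

theorem Iso.dim_eq {X Y : QRep k I} (h : Iso X Y) : X.dim = Y.dim := by
  obtain ⟨f, -, hb⟩ := h
  funext i
  exact congrArg Nat.cast (LinearEquiv.ofBijective (f i) (hb i)).finrank_eq

open Polynomial in
/-- A linear combination of endomorphisms with polynomial coefficients which is invertible at one
point is invertible at all but finitely many points. -/
theorem finite_det_eq_zero {V : Type*} [AddCommGroup V] [Module k V] [Module.Finite k V]
    {n : Type*} [Fintype n] (c : n → k[X]) (F : n → Module.End k V) (t₀ : k)
    (h : LinearMap.det (∑ q, (c q).eval t₀ • F q) ≠ 0) :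
    {t : k | LinearMap.det (∑ q, (c q).eval t • F q) = 0}.Finite := by
  classical
  let b := Module.finBasis k V
  let P : k[X] := (∑ q, c q • (LinearMap.toMatrix b b (F q)).map C).det
  have hP : ∀ t, P.eval t = LinearMap.det (∑ q, (c q).eval t • F q) := by
    intro t
    rw [← LinearMap.det_toMatrix b, ← coe_evalRingHom, RingHom.map_det]
    congr 1
    ext r s
    simp [Matrix.sum_apply, LinearMap.toMatrix_apply]
  have hP0 : P ≠ 0 := by
    intro h0
    apply h
    rw [← hP, h0, eval_zero]
  refine (P.roots.toFinset.finite_toSet).subset fun t ht => ?_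
  rw [Finset.mem_coe, Multiset.mem_toFinset, mem_roots hP0]
  exact (hP t).trans ht

/-- The representation obtained by moving the linear maps along a line. -/
def deform (X : QRep k I) (v : ∀ (i j : I) (_ : i ⟶ j), X.V i →ₗ[k] X.V j) (t : k) : QRep k I where
  V := X.V
  map {i j} a := X.map a + t • v i j a

open Polynomial in
/-- A rigid representation `X` is isomorphic to all but finitely many representations `X_t` on a
line through it. A family `f` is a homomorphism `X → X_t` if `δ f = t • B f`, where `B f = v ∘ f`.
With a section `R` of `δ`, a solution is `f = id + t • R φ`, where `(1 - t • B R) φ = B id`.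
Multiplication by the determinant of `1 - t • B R` makes it a polynomial in `t`, whose value at zero
is the identity. -/
theorem Rigid.finite_not_iso_deform [Finite I] [∀ i j : I, Finite (i ⟶ j)] {X : QRep k I}
    (hX : Rigid X) (v : ∀ (i j : I) (_ : i ⟶ j), X.V i →ₗ[k] X.V j) :
    {t : k | ¬ Iso X (X.deform v t)}.Finite := by
  classical
  let B : Fam X X →ₗ[k] Cochain X X :=
    { toFun := fun f i j a => v i j a ∘ₗ f i
      map_add' := fun f g => by
        funext i j a
        exact LinearMap.comp_add _ _ _
      map_smul' := fun c f => by
        funext i j a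
        exact LinearMap.comp_smul _ _ _ }
  obtain ⟨R, hR⟩ := (δ X X).exists_rightInverse_of_surjective (LinearMap.range_eq_top.2 hX)
  replace hR : ∀ c, δ X X (R c) = c := fun c => LinearMap.congr_fun hR c
  let bs := Module.finBasis k (Cochain X X)
  let S : Module.End k (Cochain X X) := B ∘ₗ R
  let A := LinearMap.toMatrix bs bs S
  let M : Matrix _ _ k[X] := 1 - (Polynomial.X : k[X]) • A.map C
  let β := bs.repr (B (Fam.id X))
  let ψ : _ → k[X] := Matrix.mulVec M.adjugate (fun q => C (β q))
  have hMψ : ∀ t q, (ψ q).eval t - t * ∑ r, A q r * (ψ r).eval t = M.det.eval t * β q := by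
    intro t q
    have h1 : M.mulVec ψ = M.det • fun q => C (β q) := by
      rw [Matrix.mulVec_mulVec, Matrix.mul_adjugate, Matrix.smul_mulVec, Matrix.one_mulVec]
    have h2 := congrArg (fun f => (f q).eval t) h1
    rw [show M.mulVec ψ = ψ - (Polynomial.X : k[X]) • (A.map C).mulVec ψ by
      rw [Matrix.sub_mulVec, Matrix.one_mulVec, Matrix.smul_mulVec]] at h2
    simpa [Matrix.mulVec, dotProduct, eval_finsetSum] using h2
  let Ψ : k → Cochain X X := fun t => ∑ q, (ψ q).eval t • bs q
  have hΨ : ∀ t, Ψ t - t • S (Ψ t) = M.det.eval t • B (Fam.id X) := by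
    intro t
    refine bs.ext_elem fun q => ?_
    have h1 : bs.repr (Ψ t) = fun r => (ψ r).eval t := by
      funext r
      exact congrFun (bs.repr_sum_self _) r
    have h2 : bs.repr (S (Ψ t)) q = ∑ r, A q r * (ψ r).eval t := by
      rw [← LinearMap.toMatrix_mulVec_repr bs bs S, h1]
      rfl
    have h3 : bs.repr (Ψ t) q = (ψ q).eval t := congrFun h1 q
    simp only [map_sub, map_smul, Finsupp.sub_apply, Finsupp.smul_apply, smul_eq_mul, h2, h3, hMψ,
      β]
  let h : k → Fam X X := fun t => M.det.eval t • Fam.id X + t • R (Ψ t)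
  have hh : ∀ t, δ X X (h t) = t • B (h t) := by
    intro t
    have h1 : δ X X (Fam.id X) = 0 := LinearMap.mem_ker.1 (Hom.id X)
    have h2 : S (Ψ t) = B (R (Ψ t)) := rfl
    simp only [h, map_add, map_smul, h1, hR, smul_zero, zero_add, smul_add, ← h2]
    rw [smul_comm t (eval t M.det), ← smul_comm t (eval t M.det), ← hΨ t]
    simp [smul_sub]
  have hdet : ∀ i, {t : k | LinearMap.det (h t i) = 0}.Finite := by
    intro i
    let c : Option (Fin (Module.finrank k (Cochain X X))) → k[X] := fun q =>
      q.elim M.det fun q => Polynomial.X * ψ q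
    let F : Option (Fin (Module.finrank k (Cochain X X))) → Module.End k (X.V i) := fun q =>
      q.elim LinearMap.id fun q => R (bs q) i
    have hsum : ∀ t, ∑ q, (c q).eval t • F q = h t i := by
      intro t
      have h1 : R (Ψ t) i = ∑ q, (ψ q).eval t • R (bs q) i := by
        simp [Ψ]
      simp only [h, Fintype.sum_option, Pi.add_apply, Pi.smul_apply, h1, Finset.smul_sum, c, F,
        Option.elim, eval_mul, eval_X, mul_smul]
      rfl
    have hM : M.det.eval 0 = 1 := by
      rw [← coe_evalRingHom, RingHom.map_det]
      have : (evalRingHom (0 : k)).mapMatrix M = 1 := by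
        ext r s
        simp [M, Matrix.one_apply, apply_ite]
      rw [this, Matrix.det_one]
    have := finite_det_eq_zero c F 0 (by
      rw [hsum]
      simp [h, hM, Fam.id])
    simpa only [hsum] using this
  refine (Set.finite_iUnion hdet).subset fun t ht => ?_
  by_contra hcon
  simp only [Set.mem_iUnion, Set.mem_ofPred_eq, not_exists] at hcon
  refine ht ⟨h t, ?_, fun i => ?_⟩
  · refine (mem_Hom (M := X) (N := X.deform v t)).2 fun {i j} a x => ?_
    have := LinearMap.congr_fun (congrFun (congrFun (congrFun (hh t) i) j) a) x
    rw [δ_apply, sub_eq_iff_eq_add'] at this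
    exact this
  · have h1 : IsUnit (h t i : Module.End k (X.V i)) := by
      rw [LinearMap.isUnit_iff_isUnit_det]
      exact (isUnit_iff_ne_zero).2 (hcon i)
    exact (Module.End.isUnit_iff _).1 h1

/-- Rigid representations over an infinite field are determined by their dimension vectors: each of
two rigid representations is isomorphic to almost all points of the line through both. -/
theorem Rigid.iso [Finite I] [∀ i j : I, Finite (i ⟶ j)] [Infinite k] {X Y : QRep k I}
    (hX : Rigid X) (hY : Rigid Y) (h : X.dim = Y.dim) : Iso X Y := by
  have hfr : ∀ i, Module.finrank k (X.V i) = Module.finrank k (Y.V i) := fun i => by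
    simpa [dim] using congrFun h i
  let e : ∀ i, X.V i ≃ₗ[k] Y.V i := fun i => LinearEquiv.ofFinrankEq _ _ (hfr i)
  let v : ∀ (i j : I) (_ : i ⟶ j), X.V i →ₗ[k] X.V j := fun i j a =>
    (e j).symm.toLinearMap ∘ₗ Y.map a ∘ₗ (e i).toLinearMap - X.map a
  have h1 : Iso (X.deform v 1) Y := by
    refine ⟨fun i => (e i).toLinearMap, ?_, fun i => (e i).bijective⟩
    refine (mem_Hom (M := X.deform v 1) (N := Y)).2 fun {i j} a x => ?_
    change e j (X.map a x + (1 : k) • ((e j).symm (Y.map a (e i x)) - X.map a x)) = Y.map a (e i x)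
    rw [one_smul, add_sub_cancel, LinearEquiv.apply_symm_apply]
  have hY' : Rigid (X.deform v 1) := h1.isRetract.extZero h1.isRetract hY
  have h2 : ∀ t, (X.deform v 1).deform (fun i j a => -v i j a) (1 - t) = X.deform v t := by
    intro t
    unfold deform
    congr 1
    funext i j a
    ext x
    simp [sub_smul]
  have h3 : {t : k | ¬ Iso (X.deform v 1) (X.deform v t)}.Finite := by
    have := (hY'.finite_not_iso_deform fun i j a => -v i j a).preimage
      (f := fun t : k => 1 - t) (sub_right_injective.injOn)
    simpa [h2] using this
  obtain ⟨t, ht⟩ := ((hX.finite_not_iso_deform v).union h3).exists_notMem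
  simp only [Set.mem_union, Set.mem_ofPred_eq, not_or, not_not] at ht
  exact ht.1.trans (ht.2.symm.trans h1)

end QRep

/-! ### Positive definiteness of Dynkin diagrams -/

/-- A symmetric matrix with nonpositive off-diagonal entries is positive definite as soon as it maps
some vector `w` with positive entries to a vector with positive entries: its value at `x` is the sum
of the `(C w)ᵢ xᵢ² / wᵢ` and of nonnegative multiples of the `(xᵢ / wᵢ - xⱼ / wⱼ)²`. -/
theorem dotProduct_mulVec_pos {n : Type*} [Fintype n] {C : Matrix n n ℤ}
    (hsymm : ∀ i j, C i j = C j i) (hoff : ∀ i j, i ≠ j → C i j ≤ 0) {w : n → ℤ}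
    (hw : ∀ i, 0 < w i) (hCw : ∀ i, 0 < C.mulVec w i) {x : n → ℤ} (hx : x ≠ 0) :
    0 < dotProduct x (C.mulVec x) := by
  have hw' : ∀ i, (0 : ℚ) < w i := fun i => by exact_mod_cast hw i
  have hterm : ∀ i j, (C i j : ℚ) * ((x i : ℚ) ^ 2 * w j / w i + (x j : ℚ) ^ 2 * w i / w j) / 2 ≤
      x i * C i j * x j := by
    intro i j
    rcases eq_or_ne i j with rfl | hij
    · have := (hw' i).ne'
      apply le_of_eq
      field_simp
      ring
    · have h1 : (C i j : ℚ) ≤ 0 := by exact_mod_cast hoff i j hij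
      have h2 : 2 * (x i * x j : ℚ) ≤ (x i : ℚ) ^ 2 * w j / w i + (x j : ℚ) ^ 2 * w i / w j := by
        have h3 : (x i : ℚ) ^ 2 * w j / w i + (x j : ℚ) ^ 2 * w i / w j - 2 * (x i * x j) =
            (x i * w j - x j * w i) ^ 2 / (w i * w j) := by
          have := (hw' i).ne'
          have := (hw' j).ne'
          field_simp
          ring
        have h4 : (0 : ℚ) ≤ (x i * w j - x j * w i) ^ 2 / (w i * w j) :=
          div_nonneg (sq_nonneg _) (mul_pos (hw' i) (hw' j)).le
        linarith
      nlinarith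
  have hsum : ∑ i, ∑ j, (C i j : ℚ) * ((x i : ℚ) ^ 2 * w j / w i + (x j : ℚ) ^ 2 * w i / w j) / 2 =
      ∑ i, (x i : ℚ) ^ 2 / w i * (C.mulVec w i : ℤ) := by
    have h1 : ∑ i, ∑ j, (C i j : ℚ) * ((x j : ℚ) ^ 2 * w i / w j) =
        ∑ i, ∑ j, (C i j : ℚ) * ((x i : ℚ) ^ 2 * w j / w i) := by
      rw [Finset.sum_comm]
      refine Finset.sum_congr rfl fun i _ => Finset.sum_congr rfl fun j _ => ?_
      rw [hsymm]
    have h2 : ∀ i, (x i : ℚ) ^ 2 / w i * (C.mulVec w i : ℤ) =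
        ∑ j, (C i j : ℚ) * ((x i : ℚ) ^ 2 * w j / w i) := by
      intro i
      rw [Matrix.mulVec, dotProduct]
      push_cast
      rw [Finset.mul_sum]
      refine Finset.sum_congr rfl fun j _ => ?_
      ring
    simp only [h2, ← Finset.sum_div, mul_add, Finset.sum_add_distrib, h1]
    ring
  have hform : ((dotProduct x (C.mulVec x) : ℤ) : ℚ) = ∑ i, ∑ j, (x i : ℚ) * C i j * x j := by
    simp only [dotProduct, Matrix.mulVec, Finset.mul_sum]
    push_cast
    refine Finset.sum_congr rfl fun i _ => Finset.sum_congr rfl fun j _ => ?_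
    ring
  have hpos : (0 : ℚ) < ∑ i, (x i : ℚ) ^ 2 / w i * (C.mulVec w i : ℤ) := by
    obtain ⟨i, hi⟩ := Function.ne_iff.1 hx
    have hCw' : ∀ i, (0 : ℚ) < (C.mulVec w i : ℤ) := fun i => by exact_mod_cast hCw i
    refine Finset.sum_pos' (fun j _ => ?_) ⟨i, Finset.mem_univ i, ?_⟩
    · exact mul_nonneg (div_nonneg (sq_nonneg _) (hw' j).le) (hCw' j).le
    · have : (x i : ℚ) ≠ 0 := by exact_mod_cast hi
      have := hw' i
      have := hCw' i
      positivity
  have hle := Finset.sum_le_sum fun i (_ : i ∈ Finset.univ) =>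
    Finset.sum_le_sum fun j (_ : j ∈ Finset.univ) => hterm i j
  rw [hsum, ← hform] at hle
  exact_mod_cast hpos.trans_le hle

theorem sum_range_ite_mul (n c : ℕ) (hc : c < n) (a : ℤ) (f : ℕ → ℤ) :
    ∑ j ∈ Finset.range n, (if j = c then a else 0) * f j = a * f c := by
  simp [ite_mul, hc]

/-- The weights are the coefficients of the sum of the positive roots, up to a factor. -/
theorem ADEType.exists_weights (t : ADEType) :
    ∃ w : Fin t.numVertices → ℤ, (∀ i, 0 < w i) ∧ ∀ i, 0 < t.cartanMatrix.mulVec w i := by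
  match t with
  | .A n hn =>
    let f : ℕ → ℤ := fun j => (j + 1) * (n - j)
    refine ⟨fun i : Fin n => f i, fun i : Fin n => ?_, fun i : Fin n => ?_⟩
    · have := i.2
      have : (0 : ℤ) < n - (i : ℕ) := by omega
      positivity
    · change 0 < ∑ j : Fin n, CartanMatrix.A n i j * f j
      obtain ⟨i, hi⟩ := i
      have h1 : ∑ j : Fin n, CartanMatrix.A n ⟨i, hi⟩ j * f j = ∑ j ∈ Finset.range n,
          (if i = j then (2 : ℤ) else if i + 1 = j ∨ j + 1 = i then -1 else 0) * f j := by
        rw [← Fin.sum_univ_eq_sum_range]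
        refine Finset.sum_congr rfl fun j _ => ?_
        simp [CartanMatrix.A, Fin.ext_iff]
      -- The weights extended by zero to both sides satisfy the same recursion at every vertex.
      have h2 : ∑ j ∈ Finset.range (n + 2),
          ((if j = i + 1 then (2 : ℤ) else 0) + (if j = i + 2 then (-1 : ℤ) else 0) +
            (if j = i then (-1 : ℤ) else 0)) * (j * (n + 1 - j)) = 2 := by
        simp only [add_mul, Finset.sum_add_distrib]
        rw [sum_range_ite_mul (n + 2) _ (by omega) _ (fun j : ℕ => (j : ℤ) * (n + 1 - j)),
          sum_range_ite_mul (n + 2) _ (by omega) _ (fun j : ℕ => (j : ℤ) * (n + 1 - j)),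
          sum_range_ite_mul (n + 2) _ (by omega) _ (fun j : ℕ => (j : ℤ) * (n + 1 - j))]
        push_cast
        ring
      rw [Finset.sum_range_succ, Finset.sum_range_succ'] at h2
      have h3 : ∑ j ∈ Finset.range n,
          (if i = j then (2 : ℤ) else if i + 1 = j ∨ j + 1 = i then -1 else 0) * f j =
          ∑ j ∈ Finset.range n, ((if j + 1 = i + 1 then (2 : ℤ) else 0) +
            (if j + 1 = i + 2 then (-1 : ℤ) else 0) + (if j + 1 = i then (-1 : ℤ) else 0)) *
            (((j + 1 : ℕ) : ℤ) * (n + 1 - ((j + 1 : ℕ) : ℤ))) := by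
        refine Finset.sum_congr rfl fun j _ => ?_
        congr 1
        · split_ifs <;> omega
        · simp only [f]
          push_cast
          ring
      rw [h1, h3]
      push_cast at h2 ⊢
      linarith
  | .D n hn =>
    let f : ℕ → ℤ := fun j => if j + 2 < n then 2 * (j + 1) * (2 * n - 2 - j) else n * (n - 1)
    refine ⟨fun i : Fin n => f i, fun i : Fin n => ?_, fun i : Fin n => ?_⟩
    · have := i.2
      simp only [f]
      split_ifs
      · have : (0 : ℤ) < 2 * n - 2 - (i : ℕ) := by omega
        positivity
      · have : (0 : ℤ) < n - 1 := by omega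
        positivity
    · change 0 < ∑ j : Fin n, CartanMatrix.D n i j * f j
      obtain ⟨i, hi⟩ := i
      let d : ℕ → ℤ := fun j => if i = j then 2
        else if i + 1 = j ∧ j + 2 < n then -1
        else if j + 1 = i ∧ i + 2 < n then -1
        else if i + 3 = n ∧ (j + 2 = n ∨ j + 1 = n) then -1
        else if j + 3 = n ∧ (i + 2 = n ∨ i + 1 = n) then -1 else 0
      have h1 : ∑ j : Fin n, CartanMatrix.D n ⟨i, hi⟩ j * f j =
          ∑ j ∈ Finset.range n, d j * f j := by
        rw [← Fin.sum_univ_eq_sum_range (fun j => d j * f j)]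
        refine Finset.sum_congr rfl fun j _ => ?_
        have : ¬ n ≤ 2 := by omega
        simp [CartanMatrix.D, Fin.ext_iff, this, d]
      rw [h1]
      obtain ⟨m, rfl⟩ : ∃ m, n = m + 4 := ⟨n - 4, by omega⟩
      have hsplit : i = 0 ∨ (1 ≤ i ∧ i ≤ m) ∨ i = m + 1 ∨ i = m + 2 ∨ i = m + 3 := by omega
      have hf₁ : ∀ j, j + 2 < m + 4 → f j = 2 * (j + 1) * (2 * (m + 4 : ℕ) - 2 - j) :=
        fun j hj => if_pos hj
      have hf₂ : ∀ j, ¬ j + 2 < m + 4 → f j = (m + 4 : ℕ) * ((m + 4 : ℕ) - 1) :=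
        fun j hj => if_neg hj
      rcases hsplit with rfl | ⟨h, h'⟩ | rfl | rfl | rfl
      · have hd : ∀ j ∈ Finset.range (m + 4), d j * f j =
            ((if j = 0 then (2 : ℤ) else 0) + (if j = 1 then (-1 : ℤ) else 0)) * f j := by
          intro j hj
          rw [Finset.mem_range] at hj
          congr 1
          simp only [d]
          split_ifs <;> first | omega | lia
        rw [Finset.sum_congr rfl hd]
        simp only [add_mul, Finset.sum_add_distrib]
        rw [sum_range_ite_mul _ _ (by omega),
            sum_range_ite_mul _ _ (by omega)]
        rw [hf₁ (0) (by omega), hf₁ (1) (by omega)]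
        push_cast
        nlinarith
      · obtain ⟨i, rfl⟩ : ∃ l, i = l + 1 := ⟨i - 1, by omega⟩
        have hd : ∀ j ∈ Finset.range (m + 4), d j * f j =
            ((if j = i + 1 then (2 : ℤ) else 0) + (if j = i then (-1 : ℤ) else 0) +
              (if j = i + 1 + 1 then (-1 : ℤ) else 0)) * f j := by
          intro j hj
          rw [Finset.mem_range] at hj
          congr 1
          simp only [d]
          split_ifs <;> omega
        rw [Finset.sum_congr rfl hd]
        simp only [add_mul, Finset.sum_add_distrib]
        rw [sum_range_ite_mul _ _ (by omega),
            sum_range_ite_mul _ _ (by omega),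
            sum_range_ite_mul _ _ (by omega)]
        rw [hf₁ (i + 1) (by omega), hf₁ i (by omega), hf₁ (i + 1 + 1) (by omega)]
        push_cast
        nlinarith
      · have hd : ∀ j ∈ Finset.range (m + 4), d j * f j =
            ((if j = m + 1 then (2 : ℤ) else 0) + (if j = m then (-1 : ℤ) else 0) +
              (if j = m + 2 then (-1 : ℤ) else 0) + (if j = m + 3 then (-1 : ℤ) else 0)) * f j := by
          intro j hj
          rw [Finset.mem_range] at hj
          congr 1
          simp only [d]
          split_ifs <;> first | omega | lia
        rw [Finset.sum_congr rfl hd]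
        simp only [add_mul, Finset.sum_add_distrib]
        rw [sum_range_ite_mul _ _ (by omega),
            sum_range_ite_mul _ _ (by omega),
            sum_range_ite_mul _ _ (by omega),
            sum_range_ite_mul _ _ (by omega)]
        rw [hf₁ (m + 1) (by omega), hf₁ m (by omega), hf₂ (m + 2) (by omega),
          hf₂ (m + 3) (by omega)]
        push_cast
        nlinarith
      · have hd : ∀ j ∈ Finset.range (m + 4), d j * f j =
            ((if j = m + 2 then (2 : ℤ) else 0) + (if j = m + 1 then (-1 : ℤ) else 0)) * f j := by
          intro j hj
          rw [Finset.mem_range] at hj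
          congr 1
          simp only [d]
          split_ifs <;> first | omega | lia
        rw [Finset.sum_congr rfl hd]
        simp only [add_mul, Finset.sum_add_distrib]
        rw [sum_range_ite_mul _ _ (by omega),
            sum_range_ite_mul _ _ (by omega)]
        rw [hf₂ (m + 2) (by omega), hf₁ (m + 1) (by omega)]
        push_cast
        nlinarith
      · have hd : ∀ j ∈ Finset.range (m + 4), d j * f j =
            ((if j = m + 3 then (2 : ℤ) else 0) + (if j = m + 1 then (-1 : ℤ) else 0)) * f j := by
          intro j hj
          rw [Finset.mem_range] at hj
          congr 1
          simp only [d]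
          split_ifs <;> first | omega | lia
        rw [Finset.sum_congr rfl hd]
        simp only [add_mul, Finset.sum_add_distrib]
        rw [sum_range_ite_mul _ _ (by omega),
            sum_range_ite_mul _ _ (by omega)]
        rw [hf₂ (m + 3) (by omega), hf₁ (m + 1) (by omega)]
        push_cast
        nlinarith
  | .E₆ =>
    exact ⟨(![16, 22, 30, 42, 30, 16] : Fin 6 → ℤ),
      (by decide : ∀ i : Fin 6, 0 < (![16, 22, 30, 42, 30, 16] : Fin 6 → ℤ) i),
      (by decide : ∀ i : Fin 6, 0 < CartanMatrix.E₆.mulVec ![16, 22, 30, 42, 30, 16] i)⟩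
  | .E₇ =>
    exact ⟨(![34, 49, 66, 96, 75, 52, 27] : Fin 7 → ℤ),
      (by decide : ∀ i : Fin 7, 0 < (![34, 49, 66, 96, 75, 52, 27] : Fin 7 → ℤ) i),
      (by decide : ∀ i : Fin 7, 0 < CartanMatrix.E₇.mulVec ![34, 49, 66, 96, 75, 52, 27] i)⟩
  | .E₈ =>
    exact ⟨(![92, 136, 182, 270, 220, 168, 114, 58] : Fin 8 → ℤ),
      (by decide : ∀ i : Fin 8, 0 < (![92, 136, 182, 270, 220, 168, 114, 58] : Fin 8 → ℤ) i),
      (by decide :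
        ∀ i : Fin 8, 0 < CartanMatrix.E₈.mulVec ![92, 136, 182, 270, 220, 168, 114, 58] i)⟩

/-! ### The Euler form and the roots -/

section Roots

variable {I : Type v} [Quiver.{w} I] [Fintype I] [DecidableEq I]

theorem IsDynkin.exists_weights (hI : IsDynkin I) :
    ∃ w : I → ℤ, (∀ i, 0 < w i) ∧ ∀ i, 0 < (cartan I).mulVec w i := by
  obtain ⟨m, t, e, he⟩ := hI
  choose f hf hCf using fun r => (t r).exists_weights
  refine ⟨fun i => f (e i).1 (e i).2, fun i => hf _ _, fun i => ?_⟩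
  have h : (cartan I).mulVec (fun i => f (e i).1 (e i).2) i =
      (t (e i).1).cartanMatrix.mulVec (f (e i).1) (e i).2 := by
    simp only [Matrix.mulVec, dotProduct, he]
    rw [e.sum_comp (fun p : Σ r : Fin m, Fin (t r).numVertices =>
      Matrix.blockDiagonal' (fun r => (t r).cartanMatrix) (e i) p * f p.1 p.2), Fintype.sum_sigma]
    generalize e i = p
    obtain ⟨r, a⟩ := p
    rw [Finset.sum_eq_single r]
    · simp
    · intro s _ hs
      refine Finset.sum_eq_zero fun b _ => ?_
      rw [Matrix.blockDiagonal'_apply_ne _ _ _ hs.symm, zero_mul]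
    · simp
  rw [h]
  exact hCf _ _

omit [Fintype I] in
theorem cartan_symm (i j : I) : cartan I i j = cartan I j i := by
  simp only [cartan, Matrix.of_apply, eq_comm (a := i)]
  ring

omit [Fintype I] in
theorem cartan_nonpos (i j : I) (h : i ≠ j) : cartan I i j ≤ 0 := by
  simp only [cartan, Matrix.of_apply, if_neg h]
  have := Int.natCast_nonneg (Nat.card (i ⟶ j))
  have := Int.natCast_nonneg (Nat.card (j ⟶ i))
  linarith

theorem dotProduct_cartan_mulVec (x y : I → ℤ) :
    dotProduct x ((cartan I).mulVec y) = euler x y + euler y x := by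
  simp only [dotProduct, Matrix.mulVec, cartan, Matrix.of_apply, sub_mul, Finset.sum_sub_distrib,
    mul_sub, ite_mul, zero_mul, Finset.sum_ite_eq, Finset.mem_univ, if_true, Finset.mul_sum, euler]
  have h1 : ∀ i j : I, x i * ((Nat.card (i ⟶ j) : ℤ) * y j) =
      (Nat.card (i ⟶ j) : ℤ) * (x i * y j) := fun i j => by ring
  have h2 : ∀ i j : I, x i * ((Nat.card (j ⟶ i) : ℤ) * y j) =
      (Nat.card (j ⟶ i) : ℤ) * (y j * x i) := fun i j => by ring
  have h3 : ∀ i, x i * (2 * y i) = x i * y i + y i * x i := fun i => by ring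
  simp only [h1, h2, h3, Finset.sum_add_distrib]
  rw [Finset.sum_comm (f := fun i j => (Nat.card (j ⟶ i) : ℤ) * (y j * x i))]
  ring

/-- The Euler form of a Dynkin quiver is positive definite. -/
theorem IsDynkin.one_le_euler (hI : IsDynkin I) {d : I → ℤ} (hd : d ≠ 0) : 1 ≤ euler d d := by
  obtain ⟨w, hw, hCw⟩ := hI.exists_weights
  have := dotProduct_mulVec_pos cartan_symm cartan_nonpos hw hCw hd
  rw [dotProduct_cartan_mulVec] at this
  omega

theorem simpleRoot_dotProduct_cartan_mulVec (i : I) (x : I → ℤ) :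
    dotProduct (simpleRoot i) ((cartan I).mulVec x) = (cartan I).mulVec x i := by
  simp [simpleRoot]

omit [Quiver.{w} I] [Fintype I] in
theorem simpleRoot_ne_zero (i : I) : simpleRoot i ≠ 0 := by
  simp [simpleRoot]

omit [Quiver.{w} I] [Fintype I] in
theorem simpleRoot_nonneg (i : I) : 0 ≤ simpleRoot i := by
  simp [simpleRoot]

theorem IsDynkin.euler_simpleRoot (hI : IsDynkin I) (i : I) :
    euler (simpleRoot i) (simpleRoot i) = 1 := by
  have h1 := hI.one_le_euler (simpleRoot_ne_zero i)
  have h2 := dotProduct_cartan_mulVec (simpleRoot i) (simpleRoot i)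
  rw [simpleRoot_dotProduct_cartan_mulVec] at h2
  simp only [simpleRoot, Matrix.mulVec_single, MulOpposite.op_one, one_smul, Matrix.col_apply] at h2
  simp only [cartan, Matrix.of_apply, if_true] at h2
  rw [← simpleRoot] at h2
  have := Int.natCast_nonneg (Nat.card (i ⟶ i))
  linarith

omit [DecidableEq I] in
theorem euler_sub_smul_self (x y : I → ℤ) (c : ℤ) :
    euler (x - c • y) (x - c • y) =
      euler x x - c * (euler x y + euler y x) + c ^ 2 * euler y y := by
  simp only [euler, Pi.sub_apply, Pi.smul_apply, smul_eq_mul, mul_sub, sub_mul,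
    Finset.sum_sub_distrib, Finset.mul_sum, mul_add]
  have h1 : ∑ i, x i * (c * y i) = ∑ i, c * (x i * y i) :=
    Finset.sum_congr rfl fun i _ => by ring
  have h2 : ∑ i, c * y i * x i = ∑ i, c * (y i * x i) :=
    Finset.sum_congr rfl fun i _ => by ring
  have h3 : ∑ i, c * y i * (c * y i) = ∑ i, c ^ 2 * (y i * y i) :=
    Finset.sum_congr rfl fun i _ => by ring
  have h4 : ∑ i, ∑ j, (Nat.card (i ⟶ j) : ℤ) * (x i * (c * y j)) =
      ∑ i, ∑ j, c * ((Nat.card (i ⟶ j) : ℤ) * (x i * y j)) :=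
    Finset.sum_congr rfl fun i _ => Finset.sum_congr rfl fun j _ => by ring
  have h5 : ∑ i, ∑ j, (Nat.card (i ⟶ j) : ℤ) * (c * y i * x j) =
      ∑ i, ∑ j, c * ((Nat.card (i ⟶ j) : ℤ) * (y i * x j)) :=
    Finset.sum_congr rfl fun i _ => Finset.sum_congr rfl fun j _ => by ring
  have h6 : ∑ i, ∑ j, (Nat.card (i ⟶ j) : ℤ) * (c * y i * (c * y j)) =
      ∑ i, ∑ j, c ^ 2 * ((Nat.card (i ⟶ j) : ℤ) * (y i * y j)) :=
    Finset.sum_congr rfl fun i _ => Finset.sum_congr rfl fun j _ => by ring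
  rw [h1, h2, h3, h4, h5, h6]
  ring

theorem euler_add_euler_simpleRoot (x : I → ℤ) (i : I) :
    euler x (simpleRoot i) + euler (simpleRoot i) x = (cartan I).mulVec x i := by
  rw [← simpleRoot_dotProduct_cartan_mulVec, dotProduct_cartan_mulVec, add_comm]

theorem IsDynkin.euler_eq_one_of_isRoot (hI : IsDynkin I) {x : I → ℤ} (hx : IsRoot x) :
    euler x x = 1 := by
  induction hx with
  | simple i => exact hI.euler_simpleRoot i
  | reflection i x _ ih =>
    rw [simpleReflection, euler_sub_smul_self, euler_add_euler_simpleRoot, ih,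
      hI.euler_simpleRoot]
    ring

/-- A nonnegative vector on which the Euler form takes the value one is a root: subtracting a
suitable simple root from it is the inverse of a simple reflection. -/
theorem IsDynkin.isRoot_of_euler_eq_one (hI : IsDynkin I) {x : I → ℤ} (hx : 0 ≤ x)
    (h1 : euler x x = 1) : IsRoot x := by
  induction hn : (∑ i, x i).toNat generalizing x with
  | zero =>
    have h0 : ∑ i, x i = 0 := by
      have : 0 ≤ ∑ i, x i := Finset.sum_nonneg fun i _ => hx i
      omega
    have : x = 0 := funext fun i => (Finset.sum_eq_zero_iff_of_nonneg fun i _ => hx i).1 h0 i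
      (Finset.mem_univ i)
    subst this
    simp [euler] at h1
  | succ n ih =>
    -- The value `2` of the quadratic form at `x` is the sum of the `xᵢ (C x)ᵢ`.
    obtain ⟨i, hi, hCi⟩ : ∃ i, 0 < x i ∧ 0 < (cartan I).mulVec x i := by
      by_contra! h
      have h2 := dotProduct_cartan_mulVec x x
      have h3 : dotProduct x ((cartan I).mulVec x) ≤ 0 := by
        refine Finset.sum_nonpos fun i _ => ?_
        rcases (hx i).eq_or_lt with h0 | h0
        · rw [← h0]
          simp
        · exact mul_nonpos_of_nonneg_of_nonpos h0.le (h i h0)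
      linarith
    have hq := euler_sub_smul_self x (simpleRoot i) 1
    rw [euler_add_euler_simpleRoot, h1, hI.euler_simpleRoot, one_smul] at hq
    by_cases h0 : x - simpleRoot i = 0
    · rw [sub_eq_zero.1 h0]
      exact .simple i
    · have hpos := hI.one_le_euler h0
      have hC : (cartan I).mulVec x i = 1 := by omega
      have hy : 0 ≤ x - simpleRoot i := by
        intro j
        have := hx j
        rcases eq_or_ne j i with rfl | hj
        · simp only [simpleRoot, Pi.zero_apply, Pi.sub_apply, Pi.single_eq_same]
          omega
        · simpa [simpleRoot, Pi.single_eq_of_ne hj] using this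
      have hroot := ih hy (by rw [hq, hC]; norm_num) (by
        simp only [Pi.sub_apply, Finset.sum_sub_distrib, simpleRoot, Finset.sum_pi_single',
          Finset.mem_univ, if_true]
        omega)
      have h2 : (cartan I).mulVec (x - simpleRoot i) i = -1 := by
        have h3 := euler_add_euler_simpleRoot (simpleRoot i) i
        rw [hI.euler_simpleRoot] at h3
        rw [Matrix.mulVec_sub, Pi.sub_apply, hC, ← h3]
        norm_num
      have h3 := IsRoot.reflection i _ hroot
      rw [simpleReflection, h2] at h3
      simpa using h3

omit [Quiver.{w} I] in
theorem span_simpleRoot : Submodule.span ℤ (Set.range fun i : I => simpleRoot i) = ⊤ := by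
  rw [eq_top_iff]
  intro x _
  have : x = ∑ i, x i • simpleRoot i := by
    funext j
    simp [simpleRoot, Finset.sum_apply, Pi.single_apply]
  rw [this]
  exact Submodule.sum_mem _ fun i _ => Submodule.smul_mem _ _ (Submodule.subset_span ⟨i, rfl⟩)

theorem rootLattice_eq_top : rootLattice I = ⊤ := by
  rw [eq_top_iff, ← span_simpleRoot]
  refine Submodule.span_mono ?_
  rintro _ ⟨i, rfl⟩
  exact IsRoot.simple i

end Roots

namespace QRep

variable {k : Type u} [Field k] {I : Type v} [Quiver.{w} I]

/-! ### Dimension vectors of compatible bricks are linearly independent -/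

/-- The decomposition of the extension with trivial cocycle. -/
def decompExtensionZero (A B : QRep k I) : Decomp (extension (0 : Cochain B A)) A B where
  iA := extension.inl 0
  pA := extension.fst 0
  iB := extension.inr 0
  pB := extension.snd 0
  iA_mem := extension.inl_mem 0
  pA_mem := mem_Hom.2 fun a x => by simp
  iB_mem := mem_Hom.2 fun a x => extension.ext (by simp) (by simp)
  pB_mem := extension.snd_mem 0
  pA_iA := rfl
  pB_iB := rfl
  pA_iB := Fam.ext' fun i x => extension.fst_inr 0 i x
  pB_iA := Fam.ext' fun i x => extension.snd_inl 0 i x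
  total := Fam.ext' fun i x => extension.inl_add_inr 0 i x

theorem exists_eq_smul_id [Finite I] {X : QRep k I} (hX : homDim X X = 1) (h0 : Fam.id X ≠ 0)
    {f : Fam X X} (hf : f ∈ Hom X X) : ∃ c : k, f = c • Fam.id X := by
  have h1 : Module.finrank k (Hom X X) = 1 := by
    rw [homDim] at hX
    exact_mod_cast hX
  have h2 : (⟨Fam.id X, Hom.id X⟩ : Hom X X) ≠ 0 := fun h => h0 (congrArg Subtype.val h)
  obtain ⟨c, hc⟩ := (finrank_eq_one_iff_of_nonzero' _ h2).1 h1 ⟨f, hf⟩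
  exact ⟨c, (congrArg Subtype.val hc).symm⟩

theorem indec_of_homDim_eq_one [Finite I] {X : QRep k I} (hX : homDim X X = 1)
    (h0 : Fam.id X ≠ 0) : Indec X := by
  refine ⟨h0, fun e he hee => ?_⟩
  obtain ⟨c, rfl⟩ := exists_eq_smul_id hX h0 he
  rw [Fam.smul_comp, Fam.comp_smul, Fam.comp_id, smul_smul] at hee
  have h := smul_left_injective k h0 hee
  have h' : c * (c - 1) = 0 := by
    rw [mul_sub, h, mul_one, sub_self]
  rcases mul_eq_zero.1 h' with h | h
  · exact Or.inl (by rw [h, zero_smul])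
  · exact Or.inr (by rw [sub_eq_zero.1 h, one_smul])

/-- A composition `X → Y → X` vanishes if `X` has only scalar endomorphisms and is not isomorphic to
the indecomposable representation `Y`. -/
theorem comp_eq_zero_of_not_iso [Finite I] {X Y : QRep k I} (hX : homDim X X = 1)
    (h0 : Fam.id X ≠ 0) (hY : Indec Y) (hXY : ¬ Iso X Y) {f : Fam X Y} (hf : f ∈ Hom X Y)
    {g : Fam Y X} (hg : g ∈ Hom Y X) : g.comp f = 0 := by
  obtain ⟨c, hc⟩ := exists_eq_smul_id hX h0 (Hom.comp hg hf)
  by_contra hne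
  have hc0 : c ≠ 0 := by
    rintro rfl
    exact hne (by rw [hc, zero_smul])
  have hp : (c⁻¹ • g).comp f = Fam.id X := by
    rw [Fam.smul_comp, hc, smul_smul, inv_mul_cancel₀ hc0, one_smul]
  have hpm : c⁻¹ • g ∈ Hom Y X := Submodule.smul_mem _ _ hg
  have hidem : (f.comp (c⁻¹ • g)).comp (f.comp (c⁻¹ • g)) = f.comp (c⁻¹ • g) := by
    rw [Fam.comp_assoc, ← Fam.comp_assoc (c⁻¹ • g) f, hp, Fam.id_comp]
  rcases hY.2 _ (Hom.comp hf hpm) hidem with h | h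
  · refine h0 ?_
    have h1 : (c⁻¹ • g).comp ((f.comp (c⁻¹ • g)).comp f) = Fam.id X := by
      rw [Fam.comp_assoc, hp, Fam.comp_id, hp]
    rw [← h1, h, Fam.zero_comp, Fam.comp_zero]
  · exact hXY ⟨f, hf, fun i => ⟨injective_of_retract hp i, surjective_of_retract h i⟩⟩

section Compatible

variable [Fintype I] [∀ i j : I, Finite (i ⟶ j)] {ι : Type*} {T : ι → QRep k I}

/-- Direct sums of copies of the members of a family of bricks. The last clause implies that a
member which does not occur in the direct sum is not a direct summand of it. -/
theorem exists_multiset_sum (hind : ∀ a, Indec (T a)) (hend : ∀ a, homDim (T a) (T a) = 1)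
    (hiso : ∀ a b, a ≠ b → ¬ Iso (T a) (T b)) (s : Multiset ι) :
    ∃ F : QRep k I, F.dim = (s.map fun a => (T a).dim).sum ∧
      (∀ G, (∀ a, ExtZero (T a) G) → ExtZero F G) ∧
      (∀ G, (∀ a, ExtZero G (T a)) → ExtZero G F) ∧
      (∀ a ∈ s, IsRetract (T a) F) ∧
      ∀ a ∉ s, ∀ f ∈ Hom (T a) F, ∀ g ∈ Hom F (T a), g.comp f = 0 := by
  induction s using Multiset.induction_on with
  | empty =>
    have h0 : (trivialRep k (0 : I → ℕ)).dim = 0 := by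
      rw [dim_trivialRep]
      rfl
    have h0' := id_eq_zero_iff.2 h0
    refine ⟨trivialRep k 0, by simpa using h0, fun G _ => extZero_of_id_eq_zero_left h0',
      fun G _ => extZero_of_id_eq_zero_right h0', by simp, fun a _ f _ g _ => ?_⟩
    rw [← Fam.id_comp f, h0', Fam.zero_comp, Fam.comp_zero]
  | cons b s ih =>
    obtain ⟨F, hdim, hl, hr, hret, hzero⟩ := ih
    have D := decompExtensionZero (T b) F
    refine ⟨_, ?_, fun G hG => extZero_decomp_left D (hG b) (hl G hG),
      fun G hG => extZero_decomp_right D (hG b) (hr G hG), fun a ha => ?_,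
      fun a ha f hf g hg => ?_⟩
    · rw [D.dim_eq, hdim, Multiset.map_cons, Multiset.sum_cons]
    · rcases Multiset.mem_cons.1 ha with rfl | ha
      · exact D.isRetract_left
      · exact (hret a ha).trans D.isRetract_right
    · rw [Multiset.mem_cons, not_or] at ha
      have h1 := comp_eq_zero_of_not_iso (hend a) (hind a).1 (hind b) (hiso a b ha.1)
        (Hom.comp D.pA_mem hf) (Hom.comp hg D.iA_mem)
      have h2 := hzero a ha.2 _ (Hom.comp D.pB_mem hf) _ (Hom.comp hg D.iB_mem)
      calc g.comp f = g.comp ((D.iA.comp D.pA + D.iB.comp D.pB).comp f) := by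
            rw [D.total, Fam.id_comp]
        _ = (g.comp D.iA).comp (D.pA.comp f) + (g.comp D.iB).comp (D.pB.comp f) := by
            rw [Fam.add_comp, Fam.comp_add]
            rfl
        _ = 0 := by rw [h1, h2, add_zero]

/-- Two multisets of members of a family of bricks without extensions between them consist of the
same bricks if their dimension vectors have the same sum: the two direct sums are rigid, hence
isomorphic. -/
theorem mem_of_sum_dim_eq [Infinite k] (hind : ∀ a, Indec (T a))
    (hend : ∀ a, homDim (T a) (T a) = 1) (hiso : ∀ a b, a ≠ b → ¬ Iso (T a) (T b))
    (hext : ∀ a b, ExtZero (T a) (T b)) {s t : Multiset ι}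
    (h : (s.map fun a => (T a).dim).sum = (t.map fun a => (T a).dim).sum) {a : ι} (ha : a ∈ s) :
    a ∈ t := by
  obtain ⟨F, hF, hFl, hFr, hFret, -⟩ := exists_multiset_sum hind hend hiso s
  obtain ⟨G, hG, hGl, hGr, -, hGzero⟩ := exists_multiset_sum hind hend hiso t
  have hFrig : Rigid F := hFl F fun a => hFr _ fun b => hext a b
  have hGrig : Rigid G := hGl G fun a => hGr _ fun b => hext a b
  have hiso' : Iso F G := hFrig.iso hGrig (by rw [hF, hG, h])
  by_contra hat
  obtain ⟨i, hi, p, hp, hpi⟩ := (hFret a ha).trans hiso'.isRetract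
  exact (hind a).1 (by rw [← hpi, hGzero a hat i hi p hp])

/-- The dimension vectors of pairwise nonisomorphic bricks without extensions between them are
linearly independent: a linear relation equates two nonnegative combinations with disjoint supports.
-/
theorem linearIndependent_dim [Infinite k] (hind : ∀ a, Indec (T a))
    (hend : ∀ a, homDim (T a) (T a) = 1) (hiso : ∀ a b, a ≠ b → ¬ Iso (T a) (T b))
    (hext : ∀ a b, ExtZero (T a) (T b)) : LinearIndependent ℤ fun a => (T a).dim := by
  rw [linearIndependent_iff']
  intro s g hg a ha
  let S (n : ι → ℕ) : Multiset ι := ∑ b ∈ s, n b • {b}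
  have hS : ∀ n : ι → ℕ, ((S n).map fun b => (T b).dim).sum = ∑ b ∈ s, n b • (T b).dim := by
    intro n
    simp only [S]
    clear ha hg
    classical
    induction s using Finset.induction_on with
    | empty => simp
    | insert b s hb ih =>
      rw [Finset.sum_insert hb, Finset.sum_insert hb, Multiset.map_add, Multiset.sum_add, ih,
        Multiset.map_nsmul, Multiset.sum_nsmul, Multiset.map_singleton, Multiset.sum_singleton]
  have hmem : ∀ (n : ι → ℕ) b, b ∈ S n ↔ b ∈ s ∧ n b ≠ 0 := by
    intro n b
    simp only [S, Multiset.mem_sum, Multiset.mem_nsmul, Multiset.mem_singleton]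
    constructor
    · rintro ⟨c, hc, hn, rfl⟩
      exact ⟨hc, hn⟩
    · rintro ⟨hb, hn⟩
      exact ⟨b, hb, hn, rfl⟩
  have heq : ((S fun b => (g b).toNat).map fun b => (T b).dim).sum =
      ((S fun b => (-g b).toNat).map fun b => (T b).dim).sum := by
    rw [hS, hS, ← sub_eq_zero, ← Finset.sum_sub_distrib, ← hg]
    refine Finset.sum_congr rfl fun b _ => ?_
    rw [← natCast_zsmul, ← natCast_zsmul, ← sub_smul, Int.toNat_sub_toNat_neg]
  by_contra h0
  rcases lt_or_gt_of_ne h0 with h | h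
  · have := (hmem _ a).1 (mem_of_sum_dim_eq hind hend hiso hext heq.symm
      ((hmem _ a).2 ⟨ha, by omega⟩))
    omega
  · have := (hmem _ a).1 (mem_of_sum_dim_eq hind hend hiso hext heq
      ((hmem _ a).2 ⟨ha, by omega⟩))
    omega

end Compatible

end QRep

namespace QRep

variable {k : Type u} [Field k] {I : Type v} [Quiver.{w} I]

/-! ### Completion of a family of compatible representations -/

/-- The dimension vector of `F` lies in every subgroup which contains those of the indecomposable
summands of `F`. -/
theorem dim_mem_of_forall_indec [Fintype I] (S : Submodule ℤ (I → ℤ)) {F : QRep k I}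
    (h : ∀ X : QRep k I, Indec X → IsRetract X F → X.dim ∈ S) : F.dim ∈ S := by
  induction hn : F.size using Nat.strong_induction_on generalizing F with
  | _ n ih =>
  subst hn
  rcases zero_or_indec_or_decomp F with h0 | hF | ⟨A, B, D, hA, hB⟩
  · rw [id_eq_zero_iff.1 h0]
    exact S.zero_mem
  · exact h F hF (.refl F)
  · have hs := D.size_eq
    have hA' : A.size ≠ 0 := fun h => hA (size_eq_zero_iff.1 h)
    have hB' : B.size ≠ 0 := fun h => hB (size_eq_zero_iff.1 h)
    rw [D.dim_eq]
    exact S.add_mem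
      (ih _ (by omega) (fun X hX hr => h X hX (hr.trans D.isRetract_left)) rfl)
      (ih _ (by omega) (fun X hX hr => h X hX (hr.trans D.isRetract_right)) rfl)

variable [Fintype I] [∀ i j : I, Finite (i ⟶ j)] {ι : Type*} [Fintype ι] {T : ι → QRep k I}

/-- Bongartz's construction: successive nonsplit extensions of `F` with the `T a` on either side
remove all extensions between `F` and the `T a`, since they decrease the total dimension of the
extension spaces. -/
theorem exists_extZero_family (hext : ∀ a b, ExtZero (T a) (T b)) (F₀ : QRep k I) :
    ∃ F : QRep k I, (∃ n : ι → ℕ, F.dim = F₀.dim + ∑ a, n a • (T a).dim) ∧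
      ∀ a, ExtZero (T a) F ∧ ExtZero F (T a) := by
  classical
  let m (F : QRep k I) : ℤ := ∑ a, ((homDim (T a) F - euler (T a).dim F.dim) +
    (homDim F (T a) - euler F.dim (T a).dim))
  have hm : ∀ F, 0 ≤ m F := fun F => Finset.sum_nonneg fun a _ => by
    have h1 := euler_le_homDim (T a) F
    have h2 := euler_le_homDim F (T a)
    linarith
  obtain ⟨F, ⟨n, hF⟩, hmin⟩ := exists_minimalFor_of_wellFoundedLT
    (fun F : QRep k I => ∃ n : ι → ℕ, F.dim = F₀.dim + ∑ a, n a • (T a).dim)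
    (fun F => (m F).toNat) ⟨F₀, 0, by simp⟩
  have hstep : ∀ (F' : QRep k I) (b : ι), F'.dim = F.dim + (T b).dim → m F ≤ m F' := by
    intro F' b hF'
    have := hmin (j := F') ⟨n + Pi.single b 1, by
      simp [hF', hF, add_smul, Finset.sum_add_distrib, Pi.single_apply, ite_smul, add_assoc]⟩
    have h1 := hm F
    have h2 := hm F'
    by_contra! hlt
    have := this (by simp only; omega)
    simp only at this
    omega
  have hext' := fun a b => (extZero_iff (T a) (T b)).1 (hext a b)
  refine ⟨F, ⟨n, hF⟩, fun b => ⟨?_, ?_⟩⟩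
  · by_contra hne
    obtain ⟨c, hc⟩ : ∃ c, c ∉ LinearMap.range (δ (T b) F) := by
      simpa [ExtZero, Function.Surjective] using hne
    refine (hstep (extension c) b (extension.dim_eq c)).not_gt (Finset.sum_lt_sum (fun a _ => ?_)
      ⟨b, Finset.mem_univ b, ?_⟩)
    · have h1 := homDim_extension_right_le c (T a)
      have h2 := homDim_extension_left_le c (T a)
      rw [extension.dim_eq, euler_add_right, euler_add_left, ← hext', ← hext']
      linarith
    · have h1 := homDim_extension_right_lt c hc
      have h2 := homDim_extension_left_le c (T b)
      rw [extension.dim_eq, euler_add_right, euler_add_left, ← hext']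
      linarith
  · by_contra hne
    obtain ⟨c, hc⟩ : ∃ c, c ∉ LinearMap.range (δ F (T b)) := by
      simpa [ExtZero, Function.Surjective] using hne
    refine (hstep (extension c) b ((extension.dim_eq c).trans (add_comm _ _))).not_gt
      (Finset.sum_lt_sum (fun a _ => ?_) ⟨b, Finset.mem_univ b, ?_⟩)
    · have h1 := homDim_extension_right_le c (T a)
      have h2 := homDim_extension_left_le c (T a)
      rw [extension.dim_eq, euler_add_right, euler_add_left, ← hext', ← hext']
      linarith
    · have h1 := homDim_extension_right_le c (T b)
      have h2 := homDim_extension_left_lt c hc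
      rw [extension.dim_eq, euler_add_right, euler_add_left, ← hext']
      linarith

/-- A representation without extensions to and from the `T a` can be chosen rigid: its extensions
with the `T a` still vanish after it is replaced by an extension of two complementary summands. -/
theorem exists_rigid_extZero_family (hrig : ∀ X : QRep k I, Indec X → Rigid X)
    (hext : ∀ a b, ExtZero (T a) (T b)) (F₀ : QRep k I) :
    ∃ F : QRep k I, (∃ n : ι → ℕ, F.dim = F₀.dim + ∑ a, n a • (T a).dim) ∧
      (∀ a, ExtZero (T a) F ∧ ExtZero F (T a)) ∧ Rigid F := by
  obtain ⟨F₁, ⟨n, hn⟩, hF₁⟩ := exists_extZero_family hext F₀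
  obtain ⟨F, ⟨hdim, hF⟩, hFrig⟩ := exists_rigid hrig
    (fun F => F.dim = F₁.dim ∧ ∀ a, ExtZero (T a) F ∧ ExtZero F (T a)) (by
      rintro F A B D ⟨hdim, hF⟩ c
      have hE : (extension c).dim = F.dim := by
        rw [extension.dim_eq, D.dim_eq, add_comm]
      refine ⟨hE.trans hdim, fun a => ?_⟩
      obtain ⟨h1, h2⟩ := hF a
      rw [extZero_iff] at h1 h2 ⊢
      rw [extZero_iff, hE, ← h1, ← h2, D.homDim_right, D.homDim_left]
      have h3 := homDim_extension_right_le c (T a)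
      have h4 := homDim_extension_left_le c (T a)
      have h5 := euler_le_homDim (T a) (extension c)
      have h6 := euler_le_homDim (extension c) (T a)
      rw [hE, ← h1, D.homDim_right] at h5
      rw [hE, ← h2, D.homDim_left] at h6
      constructor <;> linarith) ⟨F₁, rfl, hF₁⟩
  exact ⟨F, ⟨n, by rw [hdim, hn]⟩, hF, hFrig⟩

end QRep

/-! ### Indecomposable decorated representations -/

open Limits in
/-- Indecomposability in the category of representations means that there are no idempotent
endomorphisms other than zero and the identity. -/
theorem Rep.indecomposable_iff {k : Type u} [Field k] {I : Type v} [Quiver.{w} I] (M : Rep k I) :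
    Indecomposable M ↔ QRep.Indec M.toQ := by
  have hzero : ∀ N : Rep k I, IsZero N ↔ QRep.Fam.id N.toQ = 0 := by
    intro N
    rw [IsZero.iff_id_eq_zero, ← Rep.homFam_id, ← Rep.homFam_zero]
    exact ⟨fun h => by rw [h], fun h => Rep.hom_ext h⟩
  constructor
  · rintro ⟨h0, h⟩
    refine ⟨fun h' => h0 ((hzero M).2 h'), fun e he hee => ?_⟩
    obtain ⟨A, B, D, hD⟩ := QRep.exists_decomp_of_idempotent he hee
    let iA : A.toRep ⟶ M := homMk (M := A.toRep) D.iA_mem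
    let pA : M ⟶ A.toRep := homMk (N := A.toRep) D.pA_mem
    let iB : B.toRep ⟶ M := homMk (M := B.toRep) D.iB_mem
    let pB : M ⟶ B.toRep := homMk (N := B.toRep) D.pB_mem
    have e1 : iA ≫ pA = 𝟙 _ := Rep.hom_ext D.pA_iA
    have e2 : iB ≫ pB = 𝟙 _ := Rep.hom_ext D.pB_iB
    have e3 : iB ≫ pA = 0 := Rep.hom_ext D.pA_iB
    have e4 : iA ≫ pB = 0 := Rep.hom_ext D.pB_iA
    have e5 : pA ≫ iA + pB ≫ iB = 𝟙 _ := Rep.hom_ext D.total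
    rcases h A.toRep B.toRep
      { hom := biprod.lift pA pB
        inv := biprod.desc iA iB
        hom_inv_id := by rw [biprod.lift_desc, e5]
        inv_hom_id := by
          apply biprod.hom_ext' <;> apply biprod.hom_ext <;> simp [e1, e2, e3, e4] } with hA | hB
    · have hA' : QRep.Fam.id A = 0 := (hzero _).1 hA
      exact Or.inl (by rw [← hD, ← QRep.Fam.comp_id D.iA, hA', QRep.Fam.comp_zero,
        QRep.Fam.zero_comp])
    · have hB' : QRep.Fam.id B = 0 := (hzero _).1 hB
      refine Or.inr ?_
      rw [← hD, ← D.total, ← QRep.Fam.comp_id D.iB, hB', QRep.Fam.comp_zero, QRep.Fam.zero_comp,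
        add_zero]
  · rintro ⟨h0, h⟩
    refine ⟨fun h' => h0 ((hzero M).1 h'), fun Y Z f => ?_⟩
    let e : M ⟶ M := f.hom ≫ biprod.fst ≫ biprod.inl ≫ f.inv
    have hee : e ≫ e = e := by simp [e]
    rcases h (Rep.homFam e) (Rep.homFam_mem e) (congrArg Rep.homFam hee) with h | h
    · left
      have he : e = 0 := Rep.hom_ext h
      rw [IsZero.iff_id_eq_zero]
      calc 𝟙 Y = biprod.inl ≫ f.inv ≫ e ≫ f.hom ≫ biprod.fst := by simp [e]
        _ = 0 := by rw [he]; simp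
    · right
      have he : e = 𝟙 M := Rep.hom_ext h
      rw [IsZero.iff_id_eq_zero]
      calc 𝟙 Z = biprod.inr ≫ f.inv ≫ 𝟙 M ≫ f.hom ≫ biprod.snd := by simp
        _ = 0 := by rw [← he]; simp [e]

namespace QRep

variable {k : Type u} [Field k] {I : Type v} [Quiver.{w} I]

/-- The restriction of a representation of the decorated quiver to the original quiver. -/
def plus (X : QRep k (Decorated I)) : QRep k I where
  V i := X.V (.pos i)
  map a := X.map ((Decorated.incl I).map a)

/-- The restriction of a family of linear maps to the original quiver. -/
def Fam.plus {X Y : QRep k (Decorated I)} (f : Fam X Y) : Fam X.plus Y.plus := fun i => f (.pos i)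

theorem mem_Hom_decorated {X Y : QRep k (Decorated I)} {f : Fam X Y} :
    f ∈ Hom X Y ↔ f.plus ∈ Hom X.plus Y.plus := by
  constructor
  · refine fun h => (mem_Hom (f := f.plus)).2 fun {i j} a x => ?_
    exact mem_Hom.1 h ((Decorated.incl I).map a) x
  · refine fun h => mem_Hom.2 fun {i j} a x => ?_
    match i, j, a with
    | .pos i, .pos j, a => exact mem_Hom.1 h (i := i) (j := j) a x

/-- An indecomposable decorated representation lives on the original vertices or on the new ones. -/
theorem Indec.plus_or_neg {X : QRep k (Decorated I)} (hX : Indec X) :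
    (Indec X.plus ∧ ∀ i, X.dim (.neg i) = 0) ∨ (X.plus.dim = 0) := by
  classical
  let e : Fam X X := fun
    | .pos _ => LinearMap.id
    | .neg _ => 0
  have he : e ∈ Hom X X := mem_Hom_decorated.2 (Hom.id X.plus)
  have hee : e.comp e = e := by
    funext i
    cases i <;> rfl
  rcases hX.2 e he hee with h | h
  · right
    rw [← id_eq_zero_iff]
    funext i
    exact congrFun h (.pos i)
  · left
    have hneg : ∀ i, (LinearMap.id : X.V (.neg i) →ₗ[k] X.V (.neg i)) = 0 :=
      fun i => (congrFun h (.neg i)).symm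
    refine ⟨⟨fun h0 => hX.1 ?_, fun f hf hff => ?_⟩, fun i => ?_⟩
    · funext i
      cases i with
      | pos i => exact congrFun h0 i
      | neg i => exact hneg i
    · let g : Fam X X := fun
        | .pos i => f i
        | .neg i => 0
      have hg : g ∈ Hom X X := mem_Hom_decorated.2 hf
      have hgg : g.comp g = g := by
        funext i
        cases i with
        | pos i => exact congrFun hff i
        | neg i => rfl
      rcases hX.2 g hg hgg with h | h
      · exact Or.inl (funext fun i => congrFun h (.pos i))
      · exact Or.inr (funext fun i => congrFun h (.pos i))
    · have : Subsingleton (X.V (.neg i)) := subsingleton_of_forall_eq 0 fun x =>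
        LinearMap.congr_fun (hneg i) x
      simp [dim, Module.finrank_zero_of_subsingleton]

/-- The representation of the decorated quiver with a given restriction to the original quiver and
with spaces of given dimensions at the new vertices. -/
def decorate (X : QRep k I) (d : I → ℕ) : QRep k (Decorated I) where
  V := fun
    | .pos i => X.V i
    | .neg i => Fin (d i) → k
  addCommGroup := fun
    | .pos i => inferInstanceAs (AddCommGroup (X.V i))
    | .neg i => inferInstanceAs (AddCommGroup (Fin (d i) → k))
  module := fun
    | .pos i => inferInstanceAs (Module k (X.V i))
    | .neg i => inferInstanceAs (Module k (Fin (d i) → k))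
  finite := fun
    | .pos i => inferInstanceAs (Module.Finite k (X.V i))
    | .neg i => inferInstanceAs (Module.Finite k (Fin (d i) → k))
  map {i j} a := match i, j, a with
    | .pos _, .pos _, a => X.map a

theorem plus_decorate (X : QRep k I) (d : I → ℕ) : (X.decorate d).plus = X := rfl

theorem dim_decorate_neg (X : QRep k I) (d : I → ℕ) (i : I) :
    (X.decorate d).dim (.neg i) = d i := by
  change ((Module.finrank k (Fin (d i) → k) : ℕ) : ℤ) = d i
  simp

theorem sdim_eq (M : DecRep k I) (i : I) :
    M.sdim i = M.toQ.plus.dim i - M.toQ.dim (.neg i) := rfl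

theorem Indec.decorate_zero {X : QRep k I} (hX : Indec X) : Indec (X.decorate 0) := by
  have hneg : ∀ (i : I) (x : (X.decorate 0).V (.neg i)), x = 0 :=
    fun i x => Subsingleton.elim (α := Fin 0 → k) _ _
  refine ⟨fun h => hX.1 (funext fun i => congrFun h (.pos i)), fun e he hee => ?_⟩
  rcases hX.2 e.plus (mem_Hom_decorated.1 he)
    (funext fun i => congrFun hee (.pos i)) with h | h
  · refine Or.inl (Fam.ext' fun i x => ?_)
    cases i with
    | pos i => exact LinearMap.congr_fun (congrFun h i) x
    | neg i => exact hneg i _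
  · refine Or.inr (Fam.ext' fun i x => ?_)
    cases i with
    | pos i => exact LinearMap.congr_fun (congrFun h i) x
    | neg i => exact (hneg i _).trans (hneg i _).symm

/-- A one-dimensional space at a new vertex is an indecomposable decorated representation. -/
theorem indec_decorate_single [DecidableEq I] {X : QRep k I} (hX : Fam.id X = 0) (i : I) :
    Indec (X.decorate (Pi.single i 1)) := by
  have hne : ∀ (j : Decorated I), j ≠ .neg i → ∀ x : (X.decorate (Pi.single i 1)).V j, x = 0 := by
    rintro (j | j) hj x
    · exact LinearMap.congr_fun (congrFun hX j) x
    · have hij : j ≠ i := fun h => hj (h ▸ rfl)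
      have : IsEmpty (Fin ((Pi.single i 1 : I → ℕ) j)) := by
        rw [Pi.single_eq_of_ne hij]
        exact Fin.isEmpty
      exact Subsingleton.elim (α := Fin ((Pi.single i 1 : I → ℕ) j) → k) _ _
  have h1 : Module.finrank k ((X.decorate (Pi.single i 1)).V (.neg i)) = 1 := by
    have := dim_decorate_neg X (Pi.single i 1) i
    simpa [dim] using this
  obtain ⟨v, hv, hspan⟩ := finrank_eq_one_iff'.1 h1
  refine ⟨fun h => hv (LinearMap.congr_fun (congrFun h (.neg i)) v), fun e _ hee => ?_⟩
  obtain ⟨c, hc⟩ := hspan (e (.neg i) v)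
  have hcc : c * (c - 1) = 0 := by
    have h2 : e (.neg i) (e (.neg i) v) = e (.neg i) v :=
      LinearMap.congr_fun (congrFun hee (.neg i)) v
    rw [← hc, map_smul, ← hc, smul_smul] at h2
    have h3 := smul_left_injective k hv h2
    rw [mul_sub, h3, mul_one, sub_self]
  have hev : ∀ x, e (.neg i) x = c • x := by
    intro x
    obtain ⟨b, rfl⟩ := hspan x
    rw [map_smul, ← hc, smul_comm]
  rcases mul_eq_zero.1 hcc with h | h
  · refine Or.inl (Fam.ext' fun j x => ?_)
    by_cases hj : j = .neg i
    · subst hj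
      rw [hev, h, zero_smul]
      rfl
    · exact hne j hj _
  · refine Or.inr (Fam.ext' fun j x => ?_)
    by_cases hj : j = .neg i
    · subst hj
      rw [hev, sub_eq_zero.1 h, one_smul]
      rfl
    · exact (hne j hj _).trans (hne j hj _).symm

end QRep

/-! ### Compatibility of almost positive roots -/

open QRep

section Compatibility

variable {k : Type u} [Field k] {I : Type v} [Quiver.{w} I]

variable (k) in
/-- The representation `U_α⁺` of the original quiver. -/
noncomputable def uPlus (α : I → ℤ) : QRep k I := (U k α).plus.toQ

omit [Quiver.{w} I] in
theorem finrank_pi_linearMap_eq_zero_iff [Finite I] {M N : I → Type u} [∀ i, AddCommGroup (M i)]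
    [∀ i, Module k (M i)] [∀ i, Module.Finite k (M i)] [∀ i, AddCommGroup (N i)]
    [∀ i, Module k (N i)] [∀ i, Module.Finite k (N i)] :
    Module.finrank k (∀ i, M i →ₗ[k] N i) = 0 ↔
      ∀ i, Module.finrank k (M i) = 0 ∨ Module.finrank k (N i) = 0 := by
  cases nonempty_fintype I
  simp [Module.finrank_pi_fintype, Module.finrank_linearMap, Finset.sum_eq_zero_iff]

theorem compatDegree_eq_zero_iff [Finite I] [∀ i j : I, Finite (i ⟶ j)] (α β : I → ℤ) :
    compatDegree k α β = 0 ↔ ExtZero (uPlus k α) (uPlus k β) ∧ ExtZero (uPlus k β) (uPlus k α) ∧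
      (∀ i, (uPlus k α).dim i = 0 ∨ (U k β).toQ.dim (.neg i) = 0) ∧
      ∀ i, (U k α).toQ.dim (.neg i) = 0 ∨ (uPlus k β).dim i = 0 := by
  have h1 := Rep.finite_ext1 (U k α).plus (U k β).plus
  have h2 := Rep.finite_ext1 (U k β).plus (U k α).plus
  have h3 := Rep.finrank_ext1_eq_zero_iff (U k α).plus (U k β).plus
  have h4 := Rep.finrank_ext1_eq_zero_iff (U k β).plus (U k α).plus
  unfold compatDegree ESpace
  rw [Module.finrank_prod, Module.finrank_prod, Module.finrank_prod,
    Subspace.dual_finrank_eq, Nat.add_eq_zero_iff, Nat.add_eq_zero_iff, Nat.add_eq_zero_iff, h3, h4,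
    finrank_pi_linearMap_eq_zero_iff, finrank_pi_linearMap_eq_zero_iff]
  have hdim : ∀ (M : QRep k I) i, M.dim i = 0 ↔ Module.finrank k (M.V i) = 0 := by simp [dim]
  have hdim' : ∀ (M : QRep k (Decorated I)) i, M.dim i = 0 ↔ Module.finrank k (M.V i) = 0 := by
    simp [dim]
  simp only [hdim, hdim']
  rfl

variable [Fintype I] [DecidableEq I] [∀ i j : I, Finite (i ⟶ j)]

theorem IsDynkin.rigid_and_homDim [IsAlgClosed k] (hI : IsDynkin I) {X : QRep k I}
    (hX : Indec X) : Rigid X ∧ homDim X X = 1 :=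
  hX.rigid_and_homDim fun _ _ hd => hI.one_le_euler hd

theorem IsDynkin.dim_mem_positiveRoots [IsAlgClosed k] (hI : IsDynkin I) {X : QRep k I}
    (hX : Indec X) : X.dim ∈ positiveRoots I := by
  obtain ⟨h1, h2⟩ := hI.rigid_and_homDim hX
  exact ⟨hI.isRoot_of_euler_eq_one X.dim_nonneg (((extZero_iff X X).1 h1).symm.trans h2),
    X.dim_nonneg⟩

variable (k) in
/-- Every positive root is the dimension vector of an indecomposable representation, namely of a
rigid one. -/
theorem IsDynkin.exists_indec [IsAlgClosed k] (hI : IsDynkin I) {α : I → ℤ}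
    (hα : α ∈ positiveRoots I) : ∃ X : QRep k I, Indec X ∧ X.dim = α := by
  obtain ⟨X, hX, hrig⟩ := exists_rigid (fun X hX => (hI.rigid_and_homDim (k := k) hX).1)
    (fun X => X.dim = α) (fun F A B D hF c => by
      rw [extension.dim_eq, add_comm, ← D.dim_eq, hF]) (exists_dim_eq k hα.2)
  have h1 : homDim X X = 1 := by
    rw [(extZero_iff X X).1 hrig, hX]
    exact hI.euler_eq_one_of_isRoot hα.1
  refine ⟨X, indec_of_homDim_eq_one h1 fun h0 => ?_, hX⟩
  have h2 := hI.euler_eq_one_of_isRoot hα.1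
  rw [← hX, id_eq_zero_iff.1 h0] at h2
  simp [euler] at h2

variable (k)

/-- The representation `U_α` has the properties by which it is chosen. -/
theorem IsDynkin.U_spec [IsAlgClosed k] (hI : IsDynkin I) {α : I → ℤ}
    (hα : α ∈ almostPositiveRoots I) : Indec (U k α).toQ ∧ (U k α).sdim = α := by
  have : ∃ M : DecRep k I, Indecomposable M ∧ M.sdim = α := by
    rcases hα with hα | ⟨i, rfl⟩
    · obtain ⟨X, hX, hdim⟩ := hI.exists_indec k hα
      refine ⟨(X.decorate 0).toRep, (Rep.indecomposable_iff _).2 hX.decorate_zero, ?_⟩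
      funext i
      rw [sdim_eq, toQ_toRep, plus_decorate, dim_decorate_neg, hdim]
      simp
    · obtain ⟨X, hX⟩ := exists_dim_eq k (le_refl (0 : I → ℤ))
      refine ⟨(X.decorate (Pi.single i 1)).toRep,
        (Rep.indecomposable_iff _).2 (indec_decorate_single (id_eq_zero_iff.2 hX) i), ?_⟩
      funext j
      rw [sdim_eq, toQ_toRep, plus_decorate, dim_decorate_neg, hX]
      simp [simpleRoot, Pi.single_apply]
  have h := Classical.epsilon_spec_aux inferInstance _ this
  exact ⟨(Rep.indecomposable_iff _).1 h.1, h.2⟩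

theorem IsDynkin.U_of_positive [IsAlgClosed k] (hI : IsDynkin I) {α : I → ℤ}
    (hα : α ∈ positiveRoots I) :
    Indec (uPlus k α) ∧ (uPlus k α).dim = α ∧ ∀ i, (U k α).toQ.dim (.neg i) = 0 := by
  obtain ⟨h1, h2⟩ := hI.U_spec k (Or.inl hα)
  have h2' : ∀ i, (uPlus k α).dim i - (U k α).toQ.dim (.neg i) = α i := fun i => congrFun h2 i
  rcases h1.plus_or_neg with ⟨h3, h4⟩ | h3
  · refine ⟨h3, funext fun i => ?_, h4⟩
    rw [← h2' i, h4, sub_zero]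
  · have h0 : α = 0 := by
      refine le_antisymm (fun i => ?_) hα.2
      have h5 : (uPlus k α).dim i = 0 := congrFun h3 i
      have h6 := (U k α).toQ.dim_nonneg (.neg i)
      rw [← h2' i, h5, zero_sub]
      exact neg_nonpos.2 h6
    have h5 := hI.euler_eq_one_of_isRoot hα.1
    rw [h0] at h5
    simp [euler] at h5

theorem IsDynkin.U_of_negative [IsAlgClosed k] (hI : IsDynkin I) (i : I) :
    (uPlus k (-simpleRoot i)).dim = 0 ∧
      ∀ j, (U k (-simpleRoot i)).toQ.dim (.neg j) = simpleRoot i j := by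
  obtain ⟨h1, h2⟩ := hI.U_spec k (Or.inr ⟨i, rfl⟩)
  have h2' : ∀ j, (uPlus k (-simpleRoot i)).dim j - (U k (-simpleRoot i)).toQ.dim (.neg j) =
      -simpleRoot i j := fun j => congrFun h2 j
  rcases h1.plus_or_neg with ⟨-, h4⟩ | h3
  · have h5 := h2' i
    have h6 := (uPlus k (-simpleRoot i)).dim_nonneg i
    rw [h4, sub_zero] at h5
    simp only [Pi.zero_apply] at h6
    rw [h5] at h6
    simp [simpleRoot] at h6
  · refine ⟨h3, fun j => ?_⟩
    have h5 : (uPlus k (-simpleRoot i)).dim j = 0 := congrFun h3 j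
    have h6 := h2' j
    rw [h5] at h6
    linarith

omit [DecidableEq I] in
theorem compatDegree_comm (α β : I → ℤ) (h : compatDegree k α β = 0) : compatDegree k β α = 0 := by
  rw [compatDegree_eq_zero_iff] at *
  exact ⟨h.2.1, h.1, fun i => (h.2.2.2 i).symm, fun i => (h.2.2.1 i).symm⟩

theorem IsDynkin.compatDegree_positive [IsAlgClosed k] (hI : IsDynkin I) {α β : I → ℤ}
    (hα : α ∈ positiveRoots I) (hβ : β ∈ positiveRoots I) : compatDegree k α β = 0 ↔
      ExtZero (uPlus k α) (uPlus k β) ∧ ExtZero (uPlus k β) (uPlus k α) := by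
  rw [compatDegree_eq_zero_iff]
  have h1 := (hI.U_of_positive k hα).2.2
  have h2 := (hI.U_of_positive k hβ).2.2
  simp [h1, h2]

theorem IsDynkin.compatDegree_negative_right [IsAlgClosed k] (hI : IsDynkin I) {α : I → ℤ}
    (hα : α ∈ positiveRoots I) (i : I) : compatDegree k α (-simpleRoot i) = 0 ↔ α i = 0 := by
  rw [compatDegree_eq_zero_iff]
  obtain ⟨-, h1, h2⟩ := hI.U_of_positive k hα
  obtain ⟨h3, h4⟩ := hI.U_of_negative k i
  have h5 := id_eq_zero_iff.2 h3
  have h6 : (∀ j, α j = 0 ∨ simpleRoot i j = 0) ↔ α i = 0 := by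
    refine ⟨fun h => (h i).resolve_right (by simp [simpleRoot]), fun h j => ?_⟩
    rcases eq_or_ne j i with rfl | hj
    · exact Or.inl h
    · exact Or.inr (by simp [simpleRoot, hj])
  simp [h1, h2, h4, h6, extZero_of_id_eq_zero_left h5, extZero_of_id_eq_zero_right h5]

end Compatibility

/-! ### Clusters are bases -/

section Clusters

variable {k : Type u} [Field k] [IsAlgClosed k] {I : Type v} [Fintype I] [DecidableEq I]
  [Quiver.{w} I] [∀ i j : I, Finite (i ⟶ j)]

omit [IsAlgClosed k] [∀ i j : I, Finite (i ⟶ j)] in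
theorem IsCompatible.insert {C : Set (I → ℤ)} (hC : IsCompatible k C) {β : I → ℤ}
    (hβ : β ∈ almostPositiveRoots I) (hββ : compatDegree k β β = 0)
    (h : ∀ α ∈ C, compatDegree k α β = 0 ∧ compatDegree k β α = 0) :
    IsCompatible k (insert β C) := by
  refine ⟨Set.insert_subset hβ hC.1, ?_⟩
  rintro γ (rfl | hγ) γ' (rfl | hγ')
  · exact hββ
  · exact (h _ hγ').2
  · exact (h _ hγ).1
  · exact hC.2 _ hγ _ hγ'

theorem IsDynkin.linearIndependent_positive (hI : IsDynkin I) {C : Set (I → ℤ)}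
    (hC : IsCompatible k C) :
    LinearIndependent ℤ fun α : (C ∩ positiveRoots I : Set (I → ℤ)) => (α : I → ℤ) := by
  have hdim : ∀ α : (C ∩ positiveRoots I : Set (I → ℤ)), (uPlus k α.1).dim = α.1 :=
    fun α => (hI.U_of_positive k α.2.2).2.1
  have hind : ∀ α : (C ∩ positiveRoots I : Set (I → ℤ)), Indec (uPlus k α.1) :=
    fun α => (hI.U_of_positive k α.2.2).1
  have := linearIndependent_dim (T := fun α : (C ∩ positiveRoots I : Set (I → ℤ)) => uPlus k α.1)
    hind (fun α => (hI.rigid_and_homDim (hind α)).2) (fun α β hαβ hiso => hαβ ?_)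
    (fun α β => ((hI.compatDegree_positive k α.2.2 β.2.2).1 (hC.2 _ α.2.1 _ β.2.1)).1)
  · simpa only [hdim] using this
  · refine Subtype.ext ?_
    rw [← hdim α, ← hdim β]
    exact Iso.dim_eq hiso

/-- A compatible set is linearly independent, since its positive roots are linearly independent and
have no component at the vertices `i` for which `-αᵢ` belongs to the set. -/
theorem IsDynkin.linearIndependent_of_isCompatible (hI : IsDynkin I) {C : Set (I → ℤ)}
    (hC : IsCompatible k C) : LinearIndependent ℤ fun α : C => (α : I → ℤ) := by
  let J : Set I := {i | -simpleRoot i ∈ C}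
  have hCeq : C = C ∩ positiveRoots I ∪ (fun i => -simpleRoot i) '' J := by
    ext α
    constructor
    · intro hα
      rcases hC.1 hα with h | ⟨i, rfl⟩
      · exact Or.inl ⟨hα, h⟩
      · exact Or.inr ⟨i, hα, rfl⟩
    · rintro (h | ⟨i, hi, rfl⟩)
      · exact h.1
      · exact hi
  have h1 : LinearIndepOn ℤ id (C ∩ positiveRoots I) := hI.linearIndependent_positive hC
  have h2 : LinearIndepOn ℤ id ((fun i : I => -simpleRoot i) '' J) := by
    have h := ((Pi.basisFun ℤ I).linearIndependent.map' (LinearEquiv.neg ℤ).toLinearMap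
      (LinearEquiv.ker _)).linearIndepOn J
    have heq : (LinearEquiv.neg ℤ).toLinearMap ∘ ⇑(Pi.basisFun ℤ I) = fun i => -simpleRoot i := by
      funext i
      simp [simpleRoot]
    rw [heq] at h
    exact h.id_image
  have h3 : Disjoint (Submodule.span ℤ (C ∩ positiveRoots I))
      (Submodule.span ℤ ((fun i : I => -simpleRoot i) '' J)) := by
    rw [Submodule.disjoint_def]
    intro x hx hx'
    have h5 : ∀ j ∈ J, x j = 0 := by
      intro j hj
      have hle : Submodule.span ℤ (C ∩ positiveRoots I) ≤ LinearMap.ker (LinearMap.proj j) :=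
        Submodule.span_le.2 fun α hα =>
          (hI.compatDegree_negative_right k hα.2 j).1 (hC.2 _ hα.1 _ hj)
      exact hle hx
    have h6 : ∀ i ∉ J, x i = 0 := by
      intro i hi
      have hle : Submodule.span ℤ ((fun i : I => -simpleRoot i) '' J) ≤
          LinearMap.ker (LinearMap.proj i) := by
        rw [Submodule.span_le]
        rintro _ ⟨j, hj, rfl⟩
        have hij : i ≠ j := by
          rintro rfl
          exact hi hj
        simp [simpleRoot, hij]
      exact hle hx'
    funext i
    by_cases hi : i ∈ J
    · exact h5 i hi
    · exact h6 i hi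
  have h4 := h1.id_union h2 h3
  rw [← hCeq] at h4
  exact h4

/-- A cluster `C` spans the root lattice. If `-αᵢ` does not belong to `C`, then a representation of
dimension vector `αᵢ` can be completed, by adding dimension vectors in `C`, to a rigid
representation compatible with `C`. By maximality, the dimension vectors of its indecomposable
summands belong to `C`. -/
theorem IsDynkin.span_eq_top_of_isCluster (hI : IsDynkin I) {C : Set (I → ℤ)}
    (hC : IsCluster k C) : Submodule.span ℤ C = ⊤ := by
  have hcompat : IsCompatible k C := hC.prop
  have : Finite (C ∩ positiveRoots I : Set (I → ℤ)) :=
    (hI.linearIndependent_positive hcompat).finite_of_isNoetherian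
  cases nonempty_fintype (C ∩ positiveRoots I : Set (I → ℤ))
  rw [eq_top_iff, ← span_simpleRoot, Submodule.span_le]
  rintro _ ⟨i, rfl⟩
  by_cases hi : -simpleRoot i ∈ C
  · have := Submodule.neg_mem _ (Submodule.subset_span (R := ℤ) hi)
    simpa using this
  have hrig : ∀ X : QRep k I, Indec X → Rigid X := fun X hX => (hI.rigid_and_homDim hX).1
  obtain ⟨F₀, hF₀⟩ := exists_dim_eq k (simpleRoot_nonneg i)
  obtain ⟨F, ⟨n, hn⟩, hext, hF⟩ := exists_rigid_extZero_family hrig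
    (T := fun α : (C ∩ positiveRoots I : Set (I → ℤ)) => uPlus k α.1)
    (fun α β => ((hI.compatDegree_positive k α.2.2 β.2.2).1
      (hcompat.2 _ α.2.1 _ β.2.1)).1) F₀
  have hdim : ∀ α : (C ∩ positiveRoots I : Set (I → ℤ)), (uPlus k α.1).dim = α.1 :=
    fun α => (hI.U_of_positive k α.2.2).2.1
  simp only [hdim, hF₀] at hn
  have hFC : F.dim ∈ Submodule.span ℤ C := by
    refine dim_mem_of_forall_indec _ fun X hX hXF => Submodule.subset_span ?_
    have hβ := hI.dim_mem_positiveRoots hX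
    obtain ⟨hU, hUdim, -⟩ := hI.U_of_positive k hβ
    -- The representation `U_β` of the root `β = dim X` corresponds to `X`, up to isomorphism.
    have hUX : IsRetract (uPlus k X.dim) X := ((hrig _ hU).iso (hrig _ hX) hUdim).isRetract
    have hUF := hUX.trans hXF
    have hcomp : ∀ α ∈ C, compatDegree k X.dim α = 0 := by
      intro α hα
      rcases hcompat.1 hα with hα' | ⟨j, rfl⟩
      · obtain ⟨h1, h2⟩ := hext ⟨α, hα, hα'⟩
        exact (hI.compatDegree_positive k hβ hα').2
          ⟨hUF.extZero (.refl _) h2, (IsRetract.refl _).extZero hUF h1⟩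
      · rw [hI.compatDegree_negative_right k hβ]
        have hFj : F.dim j = 0 := by
          rw [hn, Pi.add_apply, Finset.sum_apply]
          have hij : j ≠ i := by
            rintro rfl
            exact hi hα
          have h0 : ∀ α : (C ∩ positiveRoots I : Set (I → ℤ)), α.1 j = 0 := fun α =>
            (hI.compatDegree_negative_right k α.2.2 j).1 (hcompat.2 _ α.2.1 _ hα)
          simp [simpleRoot, hij, h0]
        exact le_antisymm ((IsRetract.dim_le hXF j).trans hFj.le) (X.dim_nonneg j)
    refine hC.mem_of_prop_insert (hcompat.insert (Or.inl hβ) ?_ fun α hα =>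
      ⟨compatDegree_comm k _ _ (hcomp α hα), hcomp α hα⟩)
    exact (hI.compatDegree_positive k hβ hβ).2 ⟨hrig _ hU, hrig _ hU⟩
  have hsum : ∑ α, n α • (α : I → ℤ) ∈ Submodule.span ℤ C :=
    Submodule.sum_mem _ fun α _ => Submodule.smul_of_tower_mem _ _ (Submodule.subset_span α.2.1)
  have := Submodule.sub_mem _ hFC hsum
  rwa [hn, add_sub_cancel_right] at this

end Clusters

end DynkinQuiver

theorem proposition3p3 {k : Type u} [Field k] [IsAlgClosed k]
    {I : Type v} [Fintype I] [DecidableEq I] [Quiver.{w} I] [∀ i j : I, Finite (i ⟶ j)]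
    (hI : DynkinQuiver.IsDynkin I) (C : Set (I → ℤ)) (hC : DynkinQuiver.IsCluster k C) :
    C.encard = (DynkinQuiver.rank I : ℕ∞) ∧
      ∃ b : Module.Basis C ℤ (DynkinQuiver.rootLattice I),
        ∀ α : C, ((b α : DynkinQuiver.rootLattice I) : I → ℤ) = (α : I → ℤ) := by
  have hspan : ⊤ ≤ Submodule.span ℤ (Set.range fun α : C => (α : I → ℤ)) := by
    rw [Subtype.range_coe, hI.span_eq_top_of_isCluster hC]
  let b := (Module.Basis.mk (hI.linearIndependent_of_isCompatible hC.prop) hspan).map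
    (LinearEquiv.ofTop _ DynkinQuiver.rootLattice_eq_top).symm
  refine ⟨?_, b, fun α => ?_⟩
  · have : Finite C := Module.Finite.finite_basis b
    rw [DynkinQuiver.rank, Module.finrank_eq_nat_card_basis b, Set.encard,
      ENat.card_eq_coe_natCard]
  · simp [b]
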